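/- Let $(\mathcal H_k)_{k\in\mathbb N}$ be nonzero complex Hilbert spaces. A $C_0$-sequence is a sequence $h_k\in\mathcal H_k$ with $\sum_k|1-\|h_k\||<\infty$; two $C_0$-sequences are strongly equivalent, $h\equiv^s g$, if $\sum_k|1-\langle h_k,g_k\rangle|<\infty$. Let $\mathcal H_\otimes^2$ be von Neumann's infinite tensor product, i.e. the Hilbert space generated by the elementary tensors $\otimes_k h_k$ of $C_0$-sequences, with $\langle\otimes h_k,\otimes g_k\rangle=\prod_k\langle h_k,g_k\rangle$ if $h\equiv^s g$ and $0$ otherwise. Let $\mathcal H_\otimes^2(g)^s$ be the closed linear span of $\{\otimes_k h_k : h\equiv^s g\}$ and $\mathbf P_g^s$ the orthogonal projection onto it. For each $k$ let $\{S_k(t)\}_{t\ge 0}$ be a strongly continuous contraction semigroup on $\mathcal H_k$ with generator $A_k$. Let $\mathbf S_n(t)=S_1(t)\otimes\cdots\otimes S_n(t)\otimes I\otimes I\otimes\cdots$, a bounded operator on $\mathcal H_\otimes^2$, and let $\mathbf S(t)=\hat\otimes_{k=1}^\infty S_k(t)$ be the strong limit $\mathbf S(t)x=\lim_{n\to\infty}\mathbf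 S_n(t)x$, defined on all $x\in\mathcal H_\otimes^2$ for which this limit exists. We say that $\mathbf S(t)$ is reduced on $\mathcal H_\otimes^2(g)^s$ and is a strongly continuous contraction semigroup there if, for every $t\ge0$, $\mathbf P_g^s$ maps the domain of $\mathbf S(t)$ into itself with $\mathbf P_g^s\mathbf S(t)=\mathbf S(t)\mathbf P_g^s$ on that domain, and $\mathbf S(t)$ is defined on all of $\mathcal H_\otimes^2(g)^s$, maps it into itself, and its restrictions to it, $t\ge 0$, form a strongly continuous semigroup of contractions. A strong convergence vector for $\{A_k\}$ is an elementary tensor $g=\otimes_k g_k$ with $g_k\in D(A_k)$, $\|g_k\|=1$ for all $k$, such that $$\lim_{n\to\infty}\sum_{k=1}^n A_kg_k\otimes\Big(\bigotimes_{i\ne k}g_i\Big)$$ exists in $\mathcal H_\otimes^2$. **Theorem.** (1) If $g=\otimes_k g_k$ is a strong convergence vector for $\{A_k\}$, then $\mathbf S(t)=\hat\otimes_{k=1}^\infty S_k(t)$ is reduced on $\mathcal H_\otimes^2(g)^s$ and is a strongly continuous contraction semigroup there. (2) Conversely, let $g$ be any $C_0$-sequence. If $\mathbf S(t)$ is reduced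 on $\mathcal H_\otimes^2(g)^s$ and is a strongly continuous contraction semigroup there, then there is a strong convergence vector $f=\otimes_k f_k\in\mathcal H_\otimes^2(g)^s$ for $\{A_k\}$. -/

import Mathlib

open Filter Topology InnerProductSpace
open scoped NNReal ComplexConjugate

noncomputable section

/-! ### The infinite tensor product of von Neumann -/

namespace VonNeumann

universe u

/-- A `C₀`-sequence of von Neumann: a sequence of vectors `h i ∈ H i` with `∑ |1 - ‖h i‖| < ∞`.
These are the sequences whose elementary tensor `⊗ h i` is formed. (Von Neumann also admits sequences
for which the product of the norms converges to `0`; their elementary tensor is the zero vector.) -/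
structure C0Seq (H : ℕ → Type u) [∀ i, NormedAddCommGroup (H i)] where
  toFun : ∀ i, H i
  summable' : Summable fun i => |1 - ‖toFun i‖|

section Basic

variable {H : ℕ → Type u} [∀ i, NormedAddCommGroup (H i)]

instance : CoeFun (C0Seq H) fun _ => ∀ i, H i := ⟨C0Seq.toFun⟩

/-- Replacing one entry of a `C₀`-sequence gives a `C₀`-sequence. -/
def C0Seq.update (f : C0Seq H) (k : ℕ) (x : H k) : C0Seq H where
  toFun := Function.update f k x
  summable' := by
    refine (summable_congr_cofinite ?_).mpr f.summable'
    filter_upwards [(Set.finite_singleton k).compl_mem_cofinite] with i hi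
    have hik : i ≠ k := by simpa using hi
    simp [Function.update_of_ne hik]

@[simp] theorem C0Seq.update_self (f : C0Seq H) (k : ℕ) (x : H k) : f.update k x k = x := by
  simp [C0Seq.update]

theorem C0Seq.update_of_ne (f : C0Seq H) {k i : ℕ} (x : H k) (h : i ≠ k) :
    f.update k x i = f i := by
  simp [C0Seq.update, Function.update_of_ne h]

theorem C0Seq.summable_normSq (f : C0Seq H) : Summable fun i => |1 - ‖f i‖ ^ 2| := by
  have h0 := f.summable'
  have hb : ∀ᶠ i in cofinite, |1 - ‖f i‖| ≤ 1 :=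
    h0.tendsto_cofinite_zero.eventually_le_const one_pos
  refine (h0.mul_left 3).of_norm_bounded_eventually ?_
  filter_upwards [hb] with i hi
  have h1 : (1 - ‖f i‖ ^ 2) = (1 + ‖f i‖) * (1 - ‖f i‖) := by ring
  have h2 : |1 + ‖f i‖| ≤ 3 := by
    rw [abs_le] at hi ⊢
    constructor <;> linarith [hi.1, norm_nonneg (f i)]
  rw [Real.norm_eq_abs, abs_abs, h1, abs_mul]
  exact mul_le_mul_of_nonneg_right h2 (abs_nonneg _)

end Basic

section Tensor

variable {H : ℕ → Type u} [∀ i, NormedAddCommGroup (H i)] [∀ i, InnerProductSpace ℂ (H i)]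

/-- Strong equivalence of `C₀`-sequences: `∑ |1 - ⟨f i, g i⟩| < ∞`. -/
def StrongEquiv (f g : C0Seq H) : Prop := Summable fun i => ‖1 - ⟪f i, g i⟫_ℂ‖

theorem StrongEquiv.refl (f : C0Seq H) : StrongEquiv f f := by
  refine f.summable_normSq.congr fun i => ?_
  rw [inner_self_eq_norm_sq_to_K, ← Real.norm_eq_abs, ← Complex.norm_real]
  push_cast
  rfl

theorem StrongEquiv.symm {f g : C0Seq H} (h : StrongEquiv f g) : StrongEquiv g f := by
  refine Summable.congr h fun i => ?_
  rw [← inner_conj_symm (f i) (g i), ← Complex.norm_conj]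
  simp

theorem StrongEquiv.summable_sub {f g : C0Seq H} (h : StrongEquiv f g) :
    Summable fun i => ‖f i - g i‖ ^ 2 := by
  refine ((f.summable_normSq.add g.summable_normSq).add (Summable.mul_left 2 h)).of_nonneg_of_le
    (fun i => sq_nonneg _) fun i => ?_
  have h1 := norm_sub_sq (𝕜 := ℂ) (f i) (g i)
  have h2 : (1 - ⟪f i, g i⟫_ℂ).re ≤ ‖1 - ⟪f i, g i⟫_ℂ‖ := Complex.re_le_norm _
  have h3 := neg_abs_le (1 - ‖f i‖ ^ 2)
  have h4 := neg_abs_le (1 - ‖g i‖ ^ 2)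
  simp only [Complex.sub_re, Complex.one_re] at h2
  simp only [RCLike.re_to_complex] at h1
  linarith

theorem StrongEquiv.trans {f g h : C0Seq H} (hfg : StrongEquiv f g) (hgh : StrongEquiv g h) :
    StrongEquiv f h := by
  have hb := ((Summable.add hfg hgh).add g.summable_normSq).add
    (hfg.summable_sub.add hgh.symm.summable_sub)
  refine hb.of_nonneg_of_le (fun i => norm_nonneg _) fun i => ?_
  have key : 1 - ⟪f i, h i⟫_ℂ = (1 - ⟪f i, g i⟫_ℂ) + (1 - ⟪g i, h i⟫_ℂ)
      - (((1 - ‖g i‖ ^ 2 : ℝ)) : ℂ) - ⟪f i - g i, h i - g i⟫_ℂ := by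
    have : ⟪g i, g i⟫_ℂ = (‖g i‖ : ℂ) ^ 2 := inner_self_eq_norm_sq_to_K (g i)
    simp only [inner_sub_left, inner_sub_right, this]
    push_cast
    ring
  have hc := norm_inner_le_norm (𝕜 := ℂ) (f i - g i) (h i - g i)
  have hs : ‖(((1 - ‖g i‖ ^ 2 : ℝ)) : ℂ)‖ = |1 - ‖g i‖ ^ 2| := by
    rw [Complex.norm_real, Real.norm_eq_abs]
  rw [key]
  have t1 := norm_sub_le ((1 - ⟪f i, g i⟫_ℂ) + (1 - ⟪g i, h i⟫_ℂ)
      - (((1 - ‖g i‖ ^ 2 : ℝ)) : ℂ)) (⟪f i - g i, h i - g i⟫_ℂ)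
  have t2 := norm_sub_le ((1 - ⟪f i, g i⟫_ℂ) + (1 - ⟪g i, h i⟫_ℂ)) (((1 - ‖g i‖ ^ 2 : ℝ)) : ℂ)
  have t3 := norm_add_le (1 - ⟪f i, g i⟫_ℂ) (1 - ⟪g i, h i⟫_ℂ)
  nlinarith [sq_nonneg (‖f i - g i‖ - ‖h i - g i‖), sq_nonneg ‖f i - g i‖, sq_nonneg ‖h i - g i‖]

theorem StrongEquiv.update (f : C0Seq H) (k : ℕ) (x : H k) : StrongEquiv (f.update k x) f := by
  refine (summable_congr_cofinite ?_).mpr (StrongEquiv.refl f)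
  filter_upwards [(Set.finite_singleton k).compl_mem_cofinite] with i hi
  have hik : i ≠ k := by simpa using hi
  rw [f.update_of_ne x hik]

/-- Strong equivalence as a setoid. -/
def strongSetoid (H : ℕ → Type u) [∀ i, NormedAddCommGroup (H i)]
    [∀ i, InnerProductSpace ℂ (H i)] : Setoid (C0Seq H) where
  r := StrongEquiv
  iseqv := ⟨StrongEquiv.refl, StrongEquiv.symm, StrongEquiv.trans⟩

open Classical in
/-- The inner product `⟨⊗ f i, ⊗ g i⟩ = ∏ ⟨f i, g i⟩` of two elementary tensors. The product is
unordered, and a product that is only quasi-convergent has the value `0`: for `C₀`-sequences,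
`∏ ⟨f i, g i⟩` converges to a nonzero value, or has a vanishing factor, if
`∑ |1 - ⟨f i, g i⟩| < ∞`, and it is `0` by convention or as a limit in all other cases. -/
def kernel (f g : C0Seq H) : ℂ :=
  if StrongEquiv f g then ∏' i, ⟪f i, g i⟫_ℂ else 0

theorem StrongEquiv.multipliable {f g : C0Seq H} (h : StrongEquiv f g) :
    Multipliable fun i => ⟪f i, g i⟫_ℂ := by
  have h1 : Summable fun i => ⟪f i, g i⟫_ℂ - 1 := by
    refine Summable.of_norm (Summable.congr h fun i => ?_)
    rw [norm_sub_rev]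
  refine (Complex.multipliable_one_add_of_summable h1).congr fun i => ?_
  ring

theorem StrongEquiv.tendsto_kernel {f g : C0Seq H} (h : StrongEquiv f g) :
    Tendsto (fun n => ∏ i ∈ Finset.range n, ⟪f i, g i⟫_ℂ) atTop (𝓝 (kernel f g)) := by
  rw [kernel, if_pos h]
  exact h.multipliable.hasProd.tendsto_prod_nat

open scoped ComplexOrder Matrix

theorem posSemidef_of_tendsto {X : Type*} {M : ℕ → Matrix X X ℂ} {N : Matrix X X ℂ}
    (hM : ∀ᶠ n in atTop, (M n).PosSemidef)
    (h : ∀ x y, Tendsto (fun n => M n x y) atTop (𝓝 (N x y))) : N.PosSemidef := by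
  refine ⟨?_, fun x => ?_⟩
  · ext i j
    refine tendsto_nhds_unique_of_eventuallyEq ((h j i).star) (h i j) ?_
    filter_upwards [hM] with n hn
    exact hn.1.apply i j
  · have : Tendsto (fun n => x.sum fun i xi => x.sum fun j xj => star xi * M n i j * xj) atTop
        (𝓝 (x.sum fun i xi => x.sum fun j xj => star xi * N i j * xj)) := by
      simp only [Finsupp.sum]
      exact tendsto_finsetSum _ fun i _ => tendsto_finsetSum _ fun j _ =>
        ((h i j).const_mul _).mul_const _
    exact ge_of_tendsto this (hM.mono fun n hn => hn.2 x)

theorem posSemidef_of_finset {X : Type*} {M : Matrix X X ℂ}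
    (h : ∀ s : Finset X, (M.submatrix ((↑) : s → X) (↑)).PosSemidef) : M.PosSemidef := by
  classical
  refine ⟨?_, fun x => ?_⟩
  · ext i j
    exact (h {i, j}).1.apply ⟨i, by simp⟩ ⟨j, by simp⟩
  · have := (h x.support).2 (x.subtypeDomain (· ∈ x.support))
    simpa [Finsupp.sum, ← Finset.sum_attach x.support, ← Finset.subtype_mem_eq_attach,
      ← Finsupp.subtypeDomain_apply, ← Finsupp.support_subtypeDomain] using this

theorem posSemidef_gram {X E : Type*} [NormedAddCommGroup E] [InnerProductSpace ℂ E] (v : X → E) :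
    (Matrix.gram ℂ v).PosSemidef :=
  posSemidef_of_finset fun _ => Matrix.posSemidef_gram ℂ _

theorem posSemidef_opNorm_gram {X E : Type*} [NormedAddCommGroup E] [InnerProductSpace ℂ E]
    (v : X → E) (T : E →L[ℂ] E) :
    (‖T‖ ^ 2 • Matrix.gram ℂ v - Matrix.gram ℂ (T ∘ v)).PosSemidef :=
  posSemidef_of_finset fun s => Matrix.posSemidef_opNorm_smul_gram_sub_gram (v ∘ ((↑) : s → X)) T

open Classical in
theorem posSemidef_indicator {X : Type*} (s : Setoid X) :
    (Matrix.of fun x y : X => if s x y then (1 : ℂ) else 0).PosSemidef := by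
  have := posSemidef_gram
    (fun x : X => (lp.single 2 (Quotient.mk s x) (1 : ℂ) : lp (fun _ : Quotient s => ℂ) 2))
  convert! this using 1
  ext x y
  rw [Matrix.gram_apply, lp.inner_single_left, lp.single_apply]
  simp only [Matrix.of_apply]
  by_cases h : s x y
  · have : Quotient.mk s x = Quotient.mk s y := Quotient.sound h
    simp [h, this]
  · have : Quotient.mk s x ≠ Quotient.mk s y := fun e => h (Quotient.exact e)
    simp [h, this]

theorem posSemidef_prod (s : Finset ℕ) :
    (Matrix.of fun f g : C0Seq H => ∏ i ∈ s, ⟪f i, g i⟫_ℂ).PosSemidef := by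
  classical
  induction s using Finset.induction_on with
  | empty =>
    have := posSemidef_gram (fun _ : C0Seq H => (1 : ℂ))
    convert! this using 1
    ext f g
    simp [Matrix.gram_apply]
  | insert a s ha ih =>
    have := (posSemidef_gram (fun f : C0Seq H => f a)).hadamard ih
    convert! this using 1
    ext f g
    simp [Matrix.hadamard, Matrix.gram_apply, Finset.prod_insert ha]

theorem posSemidef_kernel : (Matrix.of fun f g : C0Seq H => kernel f g).PosSemidef := by
  classical
  refine posSemidef_of_tendsto (Eventually.of_forall fun n =>
    (posSemidef_indicator (strongSetoid H)).hadamard (posSemidef_prod (Finset.range n)))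
    fun f g => ?_
  by_cases h : StrongEquiv f g
  · have h' : strongSetoid H f g := h
    simpa [Matrix.hadamard, h'] using h.tendsto_kernel
  · have h' : ¬ strongSetoid H f g := h
    simp [Matrix.hadamard, h', kernel, h]

/-- Formal finite linear combinations of elementary tensors. -/
def PreTensor (H : ℕ → Type u) [∀ i, NormedAddCommGroup (H i)]
    [∀ i, InnerProductSpace ℂ (H i)] : Type u := C0Seq H →₀ ℂ

instance : AddCommGroup (PreTensor H) := inferInstanceAs (AddCommGroup (C0Seq H →₀ ℂ))

instance : Module ℂ (PreTensor H) := inferInstanceAs (Module ℂ (C0Seq H →₀ ℂ))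

/-- The sesquilinear form with `⟨⊗ f i, ⊗ g i⟩ = ∏ ⟨f i, g i⟩`. -/
def preInner (x y : C0Seq H →₀ ℂ) : ℂ :=
  x.sum fun f a => y.sum fun g b => conj a * kernel f g * b

theorem preInner_conj_symm (x y : C0Seq H →₀ ℂ) : conj (preInner y x) = preInner x y := by
  have hK : ∀ f g : C0Seq H, conj (kernel f g) = kernel g f := fun f g =>
    posSemidef_kernel.1.apply g f
  simp only [preInner, map_finsuppSum, map_mul, hK, Complex.conj_conj]
  rw [Finsupp.sum_comm]
  refine Finsupp.sum_congr fun f _ => Finsupp.sum_congr fun g _ => ?_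
  ring

theorem preInner_add_left (x y z : C0Seq H →₀ ℂ) :
    preInner (x + y) z = preInner x z + preInner y z := by
  simp only [preInner]
  refine Finsupp.sum_add_index' (h := fun f a =>
    Finsupp.sum z fun g b => conj a * kernel f g * b) (fun f => ?_) (fun f a b => ?_)
  · simp
  · simp [← Finsupp.sum_add, add_mul]

theorem preInner_smul_left (x y : C0Seq H →₀ ℂ) (r : ℂ) :
    preInner (r • x) y = conj r * preInner x y := by
  simp only [preInner]
  refine (Finsupp.sum_smul_index (h := fun f a =>
    Finsupp.sum y fun g b => conj a * kernel f g * b) (fun f => ?_)).trans ?_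
  · simp
  · simp only [Finsupp.mul_sum, map_mul, mul_assoc]

/-- The form is a positive semidefinite Hermitian form. -/
instance preCore : PreInnerProductSpace.Core ℂ (PreTensor H) where
  inner x y := preInner x y
  conj_inner_symm x y := preInner_conj_symm x y
  re_inner_nonneg x :=
    (Complex.le_def.mp (posSemidef_kernel.2 (show C0Seq H →₀ ℂ from x))).1
  add_left x y z := preInner_add_left x y z
  smul_left x y r := preInner_smul_left x y r

instance : SeminormedAddCommGroup (PreTensor H) :=
  InnerProductSpace.Core.toSeminormedAddCommGroup (𝕜 := ℂ)

instance : InnerProductSpace ℂ (PreTensor H) := InnerProductSpace.ofCore _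

/-- The complete infinite tensor product of the Hilbert spaces `H i`: the Hilbert space generated by
the elementary tensors. -/
abbrev InfTensor (H : ℕ → Type u) [∀ i, NormedAddCommGroup (H i)]
    [∀ i, InnerProductSpace ℂ (H i)] : Type u := UniformSpace.Completion (PreTensor H)

/-- A formal linear combination as a vector of the tensor product. -/
def mkTensor (H : ℕ → Type u) [∀ i, NormedAddCommGroup (H i)]
    [∀ i, InnerProductSpace ℂ (H i)] : (C0Seq H →₀ ℂ) →ₗ[ℂ] InfTensor H :=
  (UniformSpace.Completion.toComplL (𝕜 := ℂ) (E := PreTensor H)).toLinearMap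

/-- The elementary tensor `⊗ f i`. -/
def tensor (f : C0Seq H) : InfTensor H := mkTensor H (Finsupp.single f 1)

theorem inner_mkTensor (x y : C0Seq H →₀ ℂ) :
    ⟪mkTensor H x, mkTensor H y⟫_ℂ = preInner x y :=
  UniformSpace.Completion.inner_coe (𝕜 := ℂ) (E := PreTensor H) x y

theorem denseRange_mkTensor : DenseRange (mkTensor H) :=
  UniformSpace.Completion.denseRange_coe (α := PreTensor H)

theorem inner_tensor (f g : C0Seq H) : ⟪tensor f, tensor g⟫_ℂ = kernel f g := by
  simp [tensor, inner_mkTensor, preInner]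

/-- The partial tensor product space `𝓗(g)^s`: the closed linear span of the elementary tensors
`⊗ h i` with `h` strongly equivalent to `g`. -/
def partialTensor (g : C0Seq H) : Submodule ℂ (InfTensor H) :=
  (Submodule.span ℂ {x | ∃ h : C0Seq H, StrongEquiv h g ∧ x = tensor h}).topologicalClosure

instance (g : C0Seq H) : CompleteSpace (partialTensor g) :=
  inferInstanceAs (CompleteSpace (Submodule.topologicalClosure _))

/-! ### Tensor products of operators -/

/-- The action of `T ⊗ (⊗ I)`, with `T` in slot `k`, on formal linear combinations. -/
def preAmpl (k : ℕ) (T : H k →L[ℂ] H k) : (C0Seq H →₀ ℂ) →ₗ[ℂ] InfTensor H :=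
  Finsupp.linearCombination ℂ fun f : C0Seq H => tensor (f.update k (T (f k)))

/-- The extension of a bounded operator `T` on `H k` to the tensor product, that is, the bounded
operator with `⊗ f i ↦ T f k ⊗ (⊗ over i ≠ k of f i)`. -/
def ampl (k : ℕ) (T : H k →L[ℂ] H k) : InfTensor H →L[ℂ] InfTensor H :=
  (preAmpl k T).extendOfNorm (mkTensor H)

theorem strongEquiv_update_iff (k : ℕ) (T : H k →L[ℂ] H k) (f g : C0Seq H) :
    StrongEquiv (f.update k (T (f k))) (g.update k (T (g k))) ↔ StrongEquiv f g :=
  ⟨fun h => ((StrongEquiv.update f k _).symm.trans h).trans (StrongEquiv.update g k _),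
    fun h => ((StrongEquiv.update f k _).trans h).trans (StrongEquiv.update g k _).symm⟩

theorem posSemidef_ampl (k : ℕ) (T : H k →L[ℂ] H k) :
    (Matrix.of fun f g : C0Seq H => ((‖T‖ ^ 2 : ℝ) : ℂ) * kernel f g -
      kernel (f.update k (T (f k))) (g.update k (T (g k)))).PosSemidef := by
  classical
  have hD := posSemidef_opNorm_gram (fun f : C0Seq H => f k) T
  refine posSemidef_of_tendsto (M := fun n => Matrix.hadamard
      (Matrix.of fun f g : C0Seq H => if strongSetoid H f g then (1 : ℂ) else 0)
      (Matrix.hadamard (‖T‖ ^ 2 • Matrix.gram ℂ (fun f : C0Seq H => f k) -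
          Matrix.gram ℂ (T ∘ fun f : C0Seq H => f k))
        (Matrix.of fun f g : C0Seq H => ∏ i ∈ (Finset.range n).erase k, ⟪f i, g i⟫_ℂ)))
    (Eventually.of_forall fun n => (posSemidef_indicator (strongSetoid H)).hadamard
      (hD.hadamard (posSemidef_prod _))) fun f g => ?_
  by_cases h : StrongEquiv f g
  · have h' : strongSetoid H f g := h
    have hu := ((strongEquiv_update_iff k T f g).mpr h).tendsto_kernel
    have hl := (h.tendsto_kernel.const_mul ((‖T‖ ^ 2 : ℝ) : ℂ)).sub hu
    refine hl.congr' ?_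
    filter_upwards [eventually_gt_atTop k] with n hn
    have hk : k ∈ Finset.range n := Finset.mem_range.mpr hn
    rw [← Finset.mul_prod_erase _ _ hk, ← Finset.mul_prod_erase _ _ hk]
    have hp : ∏ i ∈ (Finset.range n).erase k,
        ⟪f.update k (T (f k)) i, g.update k (T (g k)) i⟫_ℂ =
        ∏ i ∈ (Finset.range n).erase k, ⟪f i, g i⟫_ℂ :=
      Finset.prod_congr rfl fun i hi => by
        rw [f.update_of_ne _ (Finset.ne_of_mem_erase hi),
          g.update_of_ne _ (Finset.ne_of_mem_erase hi)]
    rw [hp]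
    simp [Matrix.hadamard, h', Matrix.gram_apply]
    ring
  · have h' : ¬ strongSetoid H f g := h
    have hu : ¬ StrongEquiv (f.update k (T (f k))) (g.update k (T (g k))) :=
      fun e => h ((strongEquiv_update_iff k T f g).mp e)
    simp [Matrix.hadamard, h', kernel, h, hu]

theorem norm_preAmpl_le (k : ℕ) (T : H k →L[ℂ] H k) (x : C0Seq H →₀ ℂ) :
    ‖preAmpl k T x‖ ≤ ‖T‖ * ‖mkTensor H x‖ := by
  have h := (Complex.le_def.mp ((posSemidef_ampl k T).2 x)).1
  have h1 : ((‖mkTensor H x‖ ^ 2 : ℝ) : ℂ) =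
      x.sum fun f a => x.sum fun g b => star a * kernel f g * b := by
    have := inner_mkTensor x x
    rw [inner_self_eq_norm_sq_to_K] at this
    push_cast
    exact this
  have h2 : ((‖preAmpl k T x‖ ^ 2 : ℝ) : ℂ) = x.sum fun f a => x.sum fun g b => star a *
      kernel (f.update k (T (f k))) (g.update k (T (g k))) * b := by
    have := (inner_self_eq_norm_sq_to_K (𝕜 := ℂ) (preAmpl k T x)).symm
    push_cast
    refine Eq.trans this ?_
    simp only [preAmpl, Finsupp.linearCombination_apply, Finsupp.sum]
    simp only [sum_inner]
    simp only [inner_sum, inner_smul_left, inner_smul_right, inner_tensor]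
    refine Finset.sum_congr rfl fun f _ => Finset.sum_congr rfl fun g _ => ?_
    rw [Complex.star_def]
    ring
  have h3 : (((‖T‖ ^ 2 * ‖mkTensor H x‖ ^ 2 - ‖preAmpl k T x‖ ^ 2 : ℝ)) : ℂ) =
      x.sum fun f a => x.sum fun g b => star a * (Matrix.of fun f g : C0Seq H =>
        ((‖T‖ ^ 2 : ℝ) : ℂ) * kernel f g -
        kernel (f.update k (T (f k))) (g.update k (T (g k)))) f g * b := by
    rw [Complex.ofReal_sub, Complex.ofReal_mul, h1, h2]
    simp only [Finsupp.sum, Finset.mul_sum, ← Finset.sum_sub_distrib, Matrix.of_apply]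
    refine Finset.sum_congr rfl fun f _ => Finset.sum_congr rfl fun g _ => ?_
    ring
  rw [← h3, Complex.ofReal_re, Complex.zero_re] at h
  refine abs_le_of_sq_le_sq' ?_ (by positivity) |>.2
  nlinarith [h]

/-- `ampl k T` acts on elementary tensors as it should. -/
theorem ampl_tensor (k : ℕ) (T : H k →L[ℂ] H k) (f : C0Seq H) :
    ampl k T (tensor f) = tensor (f.update k (T (f k))) := by
  rw [ampl, tensor, LinearMap.extendOfNorm_eq denseRange_mkTensor ⟨‖T‖, norm_preAmpl_le k T⟩]
  simp [preAmpl]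

/-- `ampl k T` is bounded by `‖T‖`. -/
theorem norm_ampl_apply_le (k : ℕ) (T : H k →L[ℂ] H k) (x : InfTensor H) :
    ‖ampl k T x‖ ≤ ‖T‖ * ‖x‖ :=
  LinearMap.norm_extendOfNorm_apply_le denseRange_mkTensor _ (norm_preAmpl_le k T) x

/-- The operator `T 0 ⊗ ⋯ ⊗ T (n - 1) ⊗ I ⊗ I ⊗ ⋯` on the tensor product. -/
def finTensorOp (T : ∀ k, H k →L[ℂ] H k) : ℕ → (InfTensor H →L[ℂ] InfTensor H)
  | 0 => ContinuousLinearMap.id ℂ _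
  | n + 1 => finTensorOp T n ∘L ampl n (T n)

end Tensor

/-! ### Strong limits, semigroups and generators -/

section Operators

variable {E : Type*} [NormedAddCommGroup E] [NormedSpace ℂ E]

/-- The strong limit of a family of bounded operators along a filter: the operator
`x ↦ lim L i x`, defined on all `x` for which this limit exists. -/
def strongLimit {ι : Type*} (l : Filter ι) [l.NeBot] (L : ι → E →L[ℂ] E) : E →ₗ.[ℂ] E where
  domain :=
    { carrier := {x | ∃ y, Tendsto (fun i => L i x) l (𝓝 y)}
      zero_mem' := ⟨0, by simp⟩
      add_mem' := by
        rintro x x' ⟨y, hy⟩ ⟨y', hy'⟩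
        exact ⟨y + y', by simpa using hy.add hy'⟩
      smul_mem' := by
        rintro c x ⟨y, hy⟩
        exact ⟨c • y, by simpa using hy.const_smul c⟩ }
  toFun :=
    { toFun := fun x => Classical.choose x.2
      map_add' := fun x x' => by
        refine tendsto_nhds_unique (Classical.choose_spec (x + x').2) ?_
        simpa using (Classical.choose_spec x.2).add (Classical.choose_spec x'.2)
      map_smul' := fun c x => by
        refine tendsto_nhds_unique (Classical.choose_spec (c • x).2) ?_
        simpa using (Classical.choose_spec x.2).const_smul c }

/-- `S` is a `C₀`-semigroup of contractions on `E`. -/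
structure IsContractionSemigroup (S : ℝ≥0 → E →L[ℂ] E) : Prop where
  map_zero : S 0 = ContinuousLinearMap.id ℂ E
  map_add : ∀ s t, S (s + t) = S s ∘L S t
  norm_le : ∀ t, ‖S t‖ ≤ 1
  continuous : ∀ x, Continuous fun t => S t x

/-- The infinitesimal generator `A x = lim (S t x - x) / t` as `t ↓ 0`, defined wherever the limit
exists. -/
def generator (S : ℝ≥0 → E →L[ℂ] E) : E →ₗ.[ℂ] E :=
  strongLimit (𝓝[>] (0 : ℝ≥0)) fun t => ((t : ℝ) : ℂ)⁻¹ • (S t - ContinuousLinearMap.id ℂ E)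

end Operators

section Statement

variable {H : ℕ → Type u} [∀ i, NormedAddCommGroup (H i)] [∀ i, InnerProductSpace ℂ (H i)]

/-- The infinite product `⊗ T k = s-lim (T 0 ⊗ ⋯ ⊗ T (n - 1) ⊗ I ⊗ ⋯)`, defined on all vectors of the
tensor product on which the limit exists. -/
def infTensorOp (T : ∀ k, H k →L[ℂ] H k) : InfTensor H →ₗ.[ℂ] InfTensor H :=
  strongLimit atTop (finTensorOp T)

/-! The infinite product agrees with `⊗ f k ↦ ⊗ T k (f k)` wherever the sequence `T k (f k)` is a
`C₀`-sequence that is strongly equivalent to `f`. -/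

/-- The `C₀`-sequence `T 0 (f 0), …, T (n - 1) (f (n - 1)), f n, f (n + 1), …`. -/
def C0Seq.mapLt (T : ∀ k, H k →L[ℂ] H k) : ℕ → C0Seq H → C0Seq H
  | 0, f => f
  | n + 1, f => C0Seq.mapLt T n (f.update n (T n (f n)))

theorem C0Seq.mapLt_apply (T : ∀ k, H k →L[ℂ] H k) (n : ℕ) (f : C0Seq H) (i : ℕ) :
    C0Seq.mapLt T n f i = if i < n then T i (f i) else f i := by
  induction n generalizing f with
  | zero => simp [C0Seq.mapLt]
  | succ n ih =>
    rw [C0Seq.mapLt, ih]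
    rcases lt_trichotomy i n with h | h | h
    · rw [if_pos h, if_pos (by omega), f.update_of_ne _ h.ne]
    · subst h
      simp
    · rw [if_neg (by omega), if_neg (by omega), f.update_of_ne _ h.ne']

theorem finTensorOp_tensor (T : ∀ k, H k →L[ℂ] H k) (n : ℕ) (f : C0Seq H) :
    finTensorOp T n (tensor f) = tensor (C0Seq.mapLt T n f) := by
  induction n generalizing f with
  | zero => simp [finTensorOp, C0Seq.mapLt]
  | succ n ih => simp [finTensorOp, C0Seq.mapLt, ampl_tensor, ih]

theorem tendsto_kernel_of_eq {p q : ℕ → C0Seq H} {a b c d : C0Seq H} (hab : StrongEquiv a b)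
    (hcd : StrongEquiv c d) (hp : ∀ n i, p n i = if i < n then a i else c i)
    (hq : ∀ n i, q n i = if i < n then b i else d i) :
    Tendsto (fun n => kernel (p n) (q n)) atTop (𝓝 (kernel a b)) := by
  have hpq : ∀ n, StrongEquiv (p n) (q n) := fun n => by
    refine (summable_nat_add_iff n).mp (((summable_nat_add_iff n).mpr hcd).congr fun i => ?_)
    rw [hp, hq, if_neg (by omega), if_neg (by omega)]
  have hk : ∀ n, kernel (p n) (q n) =
      (∏ i ∈ Finset.range n, ⟪a i, b i⟫_ℂ) * ∏' i, ⟪c (i + n), d (i + n)⟫_ℂ := fun n => by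
    have hm : Multipliable fun i => ⟪c (i + n), d (i + n)⟫_ℂ := by
      have h1 : Summable fun i => ⟪c (i + n), d (i + n)⟫_ℂ - 1 := by
        refine Summable.of_norm (((summable_nat_add_iff n).mpr hcd).congr fun i => ?_)
        rw [norm_sub_rev]
      refine (Complex.multipliable_one_add_of_summable h1).congr fun i => ?_
      ring
    have he : ∀ i, ⟪p n (i + n), q n (i + n)⟫_ℂ = ⟪c (i + n), d (i + n)⟫_ℂ := fun i => by
      rw [hp, hq, if_neg (by omega), if_neg (by omega)]
    have hr : ∏ i ∈ Finset.range n, ⟪p n i, q n i⟫_ℂ = ∏ i ∈ Finset.range n, ⟪a i, b i⟫_ℂ :=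
      Finset.prod_congr rfl fun i hi => by
        have := Finset.mem_range.mp hi
        rw [hp, hq, if_pos this, if_pos this]
    have hm' : Multipliable fun i => ⟪p n (i + n), q n (i + n)⟫_ℂ := by
      simpa only [he] using hm
    have hsplit := Multipliable.prod_mul_tprod_nat_mul' (f := fun i => ⟪p n i, q n i⟫_ℂ) hm'
    rw [kernel, if_pos (hpq n), ← hsplit, hr]
    simp only [he]
  have htail : Tendsto (fun n => ∏' i, ⟪c (i + n), d (i + n)⟫_ℂ) atTop (𝓝 1) := by
    have hs := tendsto_sum_nat_add fun i => ‖1 - ⟪c i, d i⟫_ℂ‖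
    have he : Tendsto (fun n => Real.exp (∑' i, ‖1 - ⟪c (i + n), d (i + n)⟫_ℂ‖) - 1) atTop
        (𝓝 0) := by
      simpa using (Real.continuous_exp.tendsto 0).comp hs |>.sub_const 1
    refine tendsto_iff_norm_sub_tendsto_zero.mpr (squeeze_zero (fun _ => norm_nonneg _)
      (fun n => ?_) he)
    have hsn : Summable fun i => ‖1 - ⟪c (i + n), d (i + n)⟫_ℂ‖ := (summable_nat_add_iff n).mpr hcd
    have h1 : Summable fun i => ⟪c (i + n), d (i + n)⟫_ℂ - 1 := by
      refine Summable.of_norm (hsn.congr fun i => ?_)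
      rw [norm_sub_rev]
    have hm : Multipliable fun i => ⟪c (i + n), d (i + n)⟫_ℂ :=
      (Complex.multipliable_one_add_of_summable h1).congr fun i => by ring
    refine le_of_tendsto (hm.hasProd.sub_const 1).norm (Eventually.of_forall fun s => ?_)
    have hle := s.norm_prod_one_add_sub_one_le fun i => ⟪c (i + n), d (i + n)⟫_ℂ - 1
    simp only [add_sub_cancel] at hle
    refine hle.trans (sub_le_sub_right (Real.exp_le_exp.mpr ?_) 1)
    simp only [norm_sub_rev _ (1 : ℂ)]
    exact hsn.sum_le_tsum s fun _ _ => norm_nonneg _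
  simp only [hk]
  simpa using hab.tendsto_kernel.mul htail

theorem infTensorOp_tensor (T : ∀ k, H k →L[ℂ] H k) (f f' : C0Seq H)
    (hf : ∀ k, f' k = T k (f k)) (hff : StrongEquiv f' f) :
    ∃ h : tensor f ∈ (infTensorOp T).domain, infTensorOp T ⟨tensor f, h⟩ = tensor f' := by
  have hlim : Tendsto (fun n => finTensorOp T n (tensor f)) atTop (𝓝 (tensor f')) := by
    have hp : ∀ n i, C0Seq.mapLt T n f i = if i < n then f' i else f i := fun n i => by
      rw [C0Seq.mapLt_apply, hf]
    have hc : ∀ n i, f' i = if i < n then f' i else f' i := fun n i => by simp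
    have h1 := tendsto_kernel_of_eq (StrongEquiv.refl f') (StrongEquiv.refl f) hp hp
    have h2 := tendsto_kernel_of_eq (q := fun _ => f') (StrongEquiv.refl f') hff.symm hp hc
    have hre := (Complex.continuous_re.tendsto _).comp h1
    have hre' := (Complex.continuous_re.tendsto _).comp h2
    rw [tendsto_iff_norm_sub_tendsto_zero]
    have hsq : Tendsto (fun n => ‖finTensorOp T n (tensor f) - tensor f'‖ ^ 2) atTop (𝓝 0) := by
      have := (hre.sub (hre'.const_mul 2)).add_const (kernel f' f').re
      have hz : (kernel f' f').re - 2 * (kernel f' f').re + (kernel f' f').re = 0 := by ring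
      rw [hz] at this
      refine this.congr fun n => ?_
      rw [norm_sub_sq (𝕜 := ℂ), finTensorOp_tensor, ← inner_self_eq_norm_sq (𝕜 := ℂ),
        ← inner_self_eq_norm_sq (𝕜 := ℂ), inner_tensor, inner_tensor, inner_tensor]
      rfl
    simpa [Real.sqrt_sq (norm_nonneg _)] using hsq.sqrt
  have hd : tensor f ∈ (infTensorOp T).domain := ⟨_, hlim⟩
  exact ⟨hd, tendsto_nhds_unique (Classical.choose_spec hd) hlim⟩

/-- `g = ⊗ g k` is a strong convergence vector for the operators `A k`: each `g k` is a unit vector in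
the domain of `A k`, and the sums over `k < n` of `A k (g k) ⊗ (⊗ over i ≠ k of g i)` converge as
`n → ∞`. -/
def IsStrongConvergenceVector (A : ∀ k, H k →ₗ.[ℂ] H k) (g : C0Seq H) : Prop :=
  (∀ k, ‖g k‖ = 1) ∧ ∃ hg : ∀ k, g k ∈ (A k).domain, ∃ v : InfTensor H,
    Tendsto (fun n => ∑ k ∈ Finset.range n, tensor (g.update k (A k ⟨g k, hg k⟩))) atTop (𝓝 v)

/-- The closed subspace `M` reduces the operator `B`: the orthogonal projection `P` onto `M` maps the
domain of `B` into itself, and `B P = P B` there. -/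
def Reduces {E : Type*} [NormedAddCommGroup E] [InnerProductSpace ℂ E] (M : Submodule ℂ E)
    [M.HasOrthogonalProjection] (B : E →ₗ.[ℂ] E) : Prop :=
  ∀ x : B.domain, ∃ h : M.starProjection x ∈ B.domain, B ⟨M.starProjection x, h⟩ =
    M.starProjection (B x)

/-- The operators `B t` are reduced on `M` and form a `C₀`-semigroup of contractions there. -/
def IsReducedContractionSemigroup {E : Type*} [NormedAddCommGroup E] [InnerProductSpace ℂ E]
    (M : Submodule ℂ E) [M.HasOrthogonalProjection] (B : ℝ≥0 → E →ₗ.[ℂ] E) : Prop :=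
  (∀ t, Reduces M (B t)) ∧ ∃ R : ℝ≥0 → M →L[ℂ] M, IsContractionSemigroup R ∧
    ∀ (t : ℝ≥0) (x : M), ∃ h : (x : E) ∈ (B t).domain, B t ⟨x, h⟩ = R t x

end Statement

end VonNeumann

end

noncomputable section

namespace VonNeumann

universe u

/-! ### Difference quotients, products of semigroups, locally uniform convergence of orbits -/

section Operators

variable {E : Type*} [NormedAddCommGroup E] [NormedSpace ℂ E]

/-! Reduction is automatic: changing finitely many entries preserves the strong equivalence class
and inequivalent elementary tensors are orthogonal, so the projection commutes with every finite
product and hence with their strong limit (`reduces_infTensorOp`). The content lies in the existence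
and continuity of the limit.

Direct part. The operators in the slots from m to n - 1 form a contraction semigroup whose generator
maps `tensor g` to the corresponding block of the series defining a strong convergence vector. Since
‖S(t)x - x‖ ≤ t‖Ax‖, the finite products applied to `tensor g` are Cauchy, uniformly for bounded t.
Operators acting on the first N slots commute with later slices, so they carry this over to vectors
that approximate every `tensor f` with f equivalent to g. The vectors with locally uniformly Cauchy
orbits form a closed subspace, which therefore contains `partialTensor g`; the limits inherit the
semigroup law and continuity.

Converse. Normalize g to unit entries. Let φ_k(s) = ⟨g_k, S_k(s)g_k⟩. The product of the φ_k(s) is a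
matrix coefficient of the limit semigroup, continuous and equal to 1 at s = 0, so it is bounded away
from 0 on some [0, τ]; hence ∑ (1 - |φ_k(s)|²) is bounded there (`exists_coeff`). Averaging each
orbit over [0, τ] and normalizing gives an equivalent sequence f of unit vectors in the domains,
with a_k = A_k f_k bounded and b_k = a_k - c_k f_k square summable, where c_k = ⟨f_k, a_k⟩
(`exists_regularization`). Applied to f, the coefficient argument and a perturbation estimate show
that the product of the exp(-s c_k) converges to a nonzero limit for all small s, so ∑ c_k converges
(`cauchySeq_sum_inner`). The b_k contribute pairwise orthogonal tensors, so the whole series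
converges. -/

theorem tendsto_strongLimit {ι : Type*} {l : Filter ι} [l.NeBot] {L : ι → E →L[ℂ] E}
    (x : (strongLimit l L).domain) : Tendsto (fun i => L i x) l (𝓝 (strongLimit l L x)) :=
  Classical.choose_spec x.2

theorem strongLimit_eq_of_tendsto {ι : Type*} {l : Filter ι} [l.NeBot] {L : ι → E →L[ℂ] E}
    {x y : E} (h : Tendsto (fun i => L i x) l (𝓝 y)) (hx : x ∈ (strongLimit l L).domain) :
    strongLimit l L ⟨x, hx⟩ = y :=
  tendsto_nhds_unique (tendsto_strongLimit ⟨x, hx⟩) h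

/-- The right difference quotient at `0` of the orbit of `x` tends to `a`. -/
def HasGenerator (S : ℝ≥0 → E →L[ℂ] E) (x a : E) : Prop :=
  Tendsto (fun t : ℝ≥0 => ((t : ℝ) : ℂ)⁻¹ • (S t x - x)) (𝓝[>] 0) (𝓝 a)

theorem hasGenerator_generator {S : ℝ≥0 → E →L[ℂ] E} (x : (generator S).domain) :
    HasGenerator S x (generator S x) :=
  tendsto_strongLimit x

theorem HasGenerator.mem_domain {S : ℝ≥0 → E →L[ℂ] E} {x a : E} (h : HasGenerator S x a) :
    x ∈ (generator S).domain :=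
  ⟨a, h⟩

theorem HasGenerator.generator_eq {S : ℝ≥0 → E →L[ℂ] E} {x a : E} (h : HasGenerator S x a)
    (hx : x ∈ (generator S).domain) : generator S ⟨x, hx⟩ = a :=
  tendsto_nhds_unique (hasGenerator_generator ⟨x, hx⟩) h

theorem HasGenerator.smul {S : ℝ≥0 → E →L[ℂ] E} {x a : E} (h : HasGenerator S x a) (c : ℂ) :
    HasGenerator S (c • x) (c • a) := by
  refine (h.const_smul c).congr fun t => ?_
  rw [map_smul, ← smul_sub, smul_comm]

theorem IsContractionSemigroup.norm_apply_le {S : ℝ≥0 → E →L[ℂ] E}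
    (hS : IsContractionSemigroup S) (t : ℝ≥0) (x : E) : ‖S t x‖ ≤ ‖x‖ :=
  ((S t).le_of_opNorm_le (hS.norm_le t) x).trans_eq (one_mul _)

/-- Telescoping: each further step of length t adds at most one increment, because S(t) does not
expand the previous error. -/
theorem IsContractionSemigroup.norm_nsmul_sub_le {S : ℝ≥0 → E →L[ℂ] E}
    (hS : IsContractionSemigroup S) (t : ℝ≥0) (x : E) (n : ℕ) :
    ‖S (n • t) x - x‖ ≤ n * ‖S t x - x‖ := by
  induction n with
  | zero => simp [hS.map_zero]
  | succ n ih =>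
    have h1 : S ((n + 1) • t) x - x = S t (S (n • t) x - x) + (S t x - x) := by
      rw [succ_nsmul', hS.map_add]
      simp
    rw [h1]
    refine (norm_add_le _ _).trans ?_
    have := hS.norm_apply_le t (S (n • t) x - x)
    push_cast
    linarith

/-- The orbit of a vector in the domain of the generator is Lipschitz at `0`. -/
theorem IsContractionSemigroup.norm_apply_sub_le {S : ℝ≥0 → E →L[ℂ] E}
    (hS : IsContractionSemigroup S) {x a : E} (ha : HasGenerator S x a) (t : ℝ≥0) :
    ‖S t x - x‖ ≤ t * ‖a‖ := by
  rcases eq_or_ne t 0 with rfl | ht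
  · simp [hS.map_zero]
  have hpos : 0 < t := pos_iff_ne_zero.mpr ht
  -- Divide t into n + 1 equal steps: n + 1 times the norm of one increment is t times that of a
  -- difference quotient, which tends to t‖a‖.
  have hlim : Tendsto (fun n : ℕ => t / ((n : ℝ≥0) + 1)) atTop (𝓝[>] 0) := by
    refine tendsto_nhdsWithin_iff.mpr ⟨?_, Eventually.of_forall fun n => ?_⟩
    · have := (tendsto_one_div_add_atTop_nhds_zero_nat (𝕜 := ℝ≥0)).const_mul t
      simpa only [mul_one_div, mul_zero] using this
    · exact div_pos hpos (by positivity)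
  have h2 := ((ha.comp hlim).norm).const_mul (t : ℝ)
  refine ge_of_tendsto h2 (Eventually.of_forall fun n => ?_)
  have h3 := hS.norm_nsmul_sub_le (t / ((n : ℝ≥0) + 1)) x (n + 1)
  have h4 : (n + 1) • (t / ((n : ℝ≥0) + 1)) = t := by
    rw [nsmul_eq_mul]
    push_cast
    field_simp
  rw [h4] at h3
  refine h3.trans_eq ?_
  have ht' : (0 : ℝ) < t := hpos
  simp only [Function.comp_apply, norm_smul, norm_inv, Complex.norm_real]
  push_cast
  rw [Real.norm_of_nonneg (by positivity)]
  field_simp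

theorem continuous_apply_of_norm_le {X : Type*} [TopologicalSpace X] {U : X → E →L[ℂ] E}
    {c : X → E} (hU : ∀ t, ‖U t‖ ≤ 1) (hUc : ∀ x, Continuous fun t => U t x)
    (hc : Continuous c) : Continuous fun t => U t (c t) := by
  refine continuous_iff_continuousAt.mpr fun t₀ => ?_
  have h1 : Tendsto (fun t => U t (c t₀)) (𝓝 t₀) (𝓝 (U t₀ (c t₀))) := (hUc _).tendsto t₀
  have h2 : Tendsto (fun t => U t (c t - c t₀)) (𝓝 t₀) (𝓝 0) := by
    refine squeeze_zero_norm (a := fun t => ‖c t - c t₀‖) (fun t => ?_) ?_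
    · exact ((U t).le_of_opNorm_le (hU t) _).trans_eq (one_mul _)
    · have := ((hc.tendsto t₀).sub_const (c t₀)).norm
      simpa using this
  have h3 := h1.add h2
  rw [add_zero] at h3
  refine h3.congr fun t => ?_
  rw [map_sub]
  abel

theorem IsContractionSemigroup.comp {U V : ℝ≥0 → E →L[ℂ] E} (hU : IsContractionSemigroup U)
    (hV : IsContractionSemigroup V) (hc : ∀ s t, U s ∘L V t = V t ∘L U s) :
    IsContractionSemigroup fun t => U t ∘L V t where
  map_zero := by
    rw [hU.map_zero, hV.map_zero]
    rfl
  map_add s t := by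
    have hc' : ∀ x, U t (V s x) = V s (U t x) := fun x => DFunLike.congr_fun (hc t s) x
    ext x
    simp [hU.map_add, hV.map_add, hc']
  norm_le t := (ContinuousLinearMap.opNorm_comp_le _ _).trans
    (mul_le_one₀ (hU.norm_le t) (norm_nonneg _) (hV.norm_le t))
  continuous x := continuous_apply_of_norm_le (U := U) hU.norm_le hU.continuous (hV.continuous x)

/-- The product rule at time 0, from UVx - x = (Ux - x) + U(Vx - x); no commutation is needed. -/
theorem HasGenerator.comp {U V : ℝ≥0 → E →L[ℂ] E} (hU : IsContractionSemigroup U) {x a b : E}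
    (ha : HasGenerator U x a) (hb : HasGenerator V x b) :
    HasGenerator (fun t => U t ∘L V t) x (a + b) := by
  have h1 : Tendsto (fun t : ℝ≥0 => U t b) (𝓝[>] 0) (𝓝 b) := by
    have := (hU.continuous b).tendsto 0
    simp only [hU.map_zero, ContinuousLinearMap.id_apply] at this
    exact this.mono_left nhdsWithin_le_nhds
  have h2 : Tendsto (fun t : ℝ≥0 => U t (((t : ℝ) : ℂ)⁻¹ • (V t x - x) - b)) (𝓝[>] 0) (𝓝 0) := by
    refine squeeze_zero_norm (fun t => hU.norm_apply_le t _) ?_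
    have := (Tendsto.sub_const hb b).norm
    simpa using this
  have h3 := (Tendsto.add ha h1).add h2
  rw [add_zero] at h3
  refine h3.congr fun t => ?_
  simp only [map_sub, map_smul, ContinuousLinearMap.comp_apply, smul_sub]
  abel

/-- The vectors whose orbits under a sequence of families of operators converge locally uniformly in
the parameter. -/
def uniformCauchyDomain (L : ℕ → ℝ≥0 → E →L[ℂ] E) : Submodule ℂ E where
  carrier := {x | ∀ τ, UniformCauchySeqOn (fun n t => L n t x) atTop (Set.Iic τ)}
  zero_mem' τ := by
    intro v hv
    refine Eventually.of_forall fun n t _ => ?_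
    simpa using refl_mem_uniformity hv
  add_mem' {x y} hx hy τ := by
    simp only [map_add]
    exact (hx τ).add (hy τ)
  smul_mem' c x hx τ := by
    simp only [map_smul]
    exact (uniformContinuous_const_smul c).comp_uniformCauchySeqOn (hx τ)

/-- An ε/3 argument: contractivity makes the approximation error uniform in both n and t. -/
theorem isClosed_uniformCauchyDomain {L : ℕ → ℝ≥0 → E →L[ℂ] E} (hL : ∀ n t, ‖L n t‖ ≤ 1) :
    IsClosed (uniformCauchyDomain L : Set E) := by
  refine isClosed_of_closure_subset fun x hx τ => ?_
  rw [Metric.uniformCauchySeqOn_iff]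
  intro ε hε
  obtain ⟨y, hy, hxy⟩ := Metric.mem_closure_iff.mp hx (ε / 3) (by positivity)
  obtain ⟨N, hN⟩ := Metric.uniformCauchySeqOn_iff.mp (hy τ) (ε / 3) (by positivity)
  refine ⟨N, fun m hm n hn t ht => ?_⟩
  have hd : ∀ n, dist (L n t x) (L n t y) ≤ dist x y := fun n => by
    rw [dist_eq_norm, dist_eq_norm, ← map_sub]
    exact ((L n t).le_of_opNorm_le (hL n t) _).trans_eq (one_mul _)
  have h1 := hd m
  have h2 := hd n
  rw [dist_comm] at h2
  have h3 := hN m hm n hn t ht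
  have h4 := dist_triangle4 (L m t x) (L m t y) (L n t y) (L n t x)
  linarith

end Operators

/-! ### Elementary tensors as functions of one entry, and operators in one slot -/

section Tensor

variable {H : ℕ → Type u} [∀ i, NormedAddCommGroup (H i)]

theorem C0Seq.ext_apply {f g : C0Seq H} (h : ∀ i, f i = g i) : f = g := by
  cases f
  cases g
  congr
  exact funext h

theorem C0Seq.update_comm (f : C0Seq H) {j k : ℕ} (h : j ≠ k) (x : H j) (y : H k) :
    (f.update j x).update k y = (f.update k y).update j x :=
  C0Seq.ext_apply fun _ => congrFun (Function.update_comm h.symm y x f.toFun).symm _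

theorem C0Seq.update_idem (f : C0Seq H) (k : ℕ) (x y : H k) :
    (f.update k x).update k y = f.update k y :=
  C0Seq.ext_apply fun _ => congrFun (Function.update_idem x y f.toFun) _

theorem C0Seq.update_eq_self (f : C0Seq H) (k : ℕ) : f.update k (f k) = f :=
  C0Seq.ext_apply fun _ => congrFun (Function.update_eq_self k f.toFun) _

variable [∀ i, InnerProductSpace ℂ (H i)]

theorem mem_partialTensor {f g : C0Seq H} (h : StrongEquiv f g) : tensor f ∈ partialTensor g :=
  Submodule.le_topologicalClosure _ (Submodule.subset_span ⟨f, h, rfl⟩)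

theorem topologicalClosure_span_tensor :
    (Submodule.span ℂ (Set.range (tensor (H := H)))).topologicalClosure = ⊤ := by
  rw [← Submodule.dense_iff_topologicalClosure_eq_top]
  refine denseRange_mkTensor.mono ?_
  rintro _ ⟨x, rfl⟩
  rw [← Finsupp.sum_single x, Finsupp.sum, map_sum]
  refine Submodule.sum_mem _ fun f _ => ?_
  have : Finsupp.single f (x f) = x f • Finsupp.single f (1 : ℂ) := by simp
  rw [this, map_smul]
  exact Submodule.smul_mem _ _ (Submodule.subset_span ⟨f, rfl⟩)

theorem ext_tensor {F : Type*} [NormedAddCommGroup F] [NormedSpace ℂ F]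
    {A B : InfTensor H →L[ℂ] F} (h : ∀ f, A (tensor f) = B (tensor f)) : A = B :=
  ContinuousLinearMap.ext_on
    ((Submodule.dense_iff_topologicalClosure_eq_top).mpr topologicalClosure_span_tensor)
    (by rintro _ ⟨f, rfl⟩; exact h f)

theorem ampl_comm {j k : ℕ} (h : j ≠ k) (A : H j →L[ℂ] H j) (B : H k →L[ℂ] H k) :
    ampl j A ∘L ampl k B = ampl k B ∘L ampl j A :=
  ext_tensor fun f => by
    simp only [ContinuousLinearMap.comp_apply, ampl_tensor]
    rw [f.update_of_ne _ h, f.update_of_ne _ h.symm, f.update_comm h]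

theorem ampl_comp (k : ℕ) (A B : H k →L[ℂ] H k) : ampl k (A ∘L B) = ampl k A ∘L ampl k B :=
  ext_tensor fun f => by
    simp [ContinuousLinearMap.comp_apply, ampl_tensor, C0Seq.update_idem]

theorem ampl_id (k : ℕ) : ampl k (ContinuousLinearMap.id ℂ (H k)) = ContinuousLinearMap.id ℂ _ :=
  ext_tensor fun f => by simp [ampl_tensor, C0Seq.update_eq_self]

theorem norm_ampl_le_one {k : ℕ} {T : H k →L[ℂ] H k} (hT : ‖T‖ ≤ 1) : ‖ampl k T‖ ≤ 1 :=
  (ContinuousLinearMap.opNorm_le_bound _ (norm_nonneg _) (norm_ampl_apply_le k T)).trans hT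

/-- The constant is the product of the factors away from k. Writing 1 for the factor at k avoids
dividing by a factor that may vanish; for inequivalent sequences the constant is 0. -/
theorem exists_kernel_update (f h : C0Seq H) (k : ℕ) :
    ∃ c : ℂ, ∀ x y : H k, kernel (f.update k x) (h.update k y) = ⟪x, y⟫_ℂ * c := by
  classical
  by_cases hfh : StrongEquiv f h
  · have hup : ∀ x y : H k, StrongEquiv (f.update k x) (h.update k y) := fun x y =>
      ((StrongEquiv.update f k x).trans hfh).trans (StrongEquiv.update h k y).symm
    refine ⟨∏' i, if i = k then 1 else ⟪f i, h i⟫_ℂ, fun x y => ?_⟩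
    have hm : Multipliable fun i => if i = k then 1 else ⟪f i, h i⟫_ℂ := by
      have h1 : Summable fun i => (if i = k then 1 else ⟪f i, h i⟫_ℂ) - 1 := by
        refine Summable.of_norm_bounded hfh fun i => ?_
        split_ifs
        · simp
        · rw [norm_sub_rev]
      exact (Complex.multipliable_one_add_of_summable h1).congr fun i => by ring
    have hs : Multipliable fun i => if i = k then ⟪x, y⟫_ℂ else 1 :=
      multipliable_of_ne_finset_one (s := {k}) fun i hi => if_neg (by simpa using hi)
    rw [kernel, if_pos (hup x y), ← tprod_ite_eq k fun _ => ⟪x, y⟫_ℂ, ← hs.tprod_mul hm]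
    refine tprod_congr fun i => ?_
    rcases eq_or_ne i k with rfl | hi
    · simp
    · rw [f.update_of_ne _ hi, h.update_of_ne _ hi, if_neg hi, if_neg hi, one_mul]
  · refine ⟨0, fun x y => ?_⟩
    rw [kernel, if_neg fun e => hfh
      (((StrongEquiv.update f k x).symm.trans e).trans (StrongEquiv.update h k y)), mul_zero]

theorem eq_zero_of_inner_tensor {x : InfTensor H} (h : ∀ f, ⟪tensor f, x⟫_ℂ = 0) : x = 0 := by
  have h1 : (innerSL ℂ x) = 0 := ext_tensor fun f => by
    simpa using (inner_eq_zero_symm.mp (h f))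
  have h2 : ⟪x, x⟫_ℂ = 0 := by
    simpa using DFunLike.congr_fun h1 x
  simpa using h2

/-- An elementary tensor as a linear function of one of its entries. -/
def slot (f : C0Seq H) (k : ℕ) : H k →ₗ[ℂ] InfTensor H where
  toFun x := tensor (f.update k x)
  map_add' x y := by
    -- Formal combinations are not linear in an entry; linearity appears in the completion, where it
    -- can be tested against elementary tensors.
    rw [← sub_eq_zero]
    refine eq_zero_of_inner_tensor fun h => ?_
    obtain ⟨c, hc⟩ := exists_kernel_update h f k
    have hc' := hc (h k)
    rw [C0Seq.update_eq_self] at hc'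
    simp only [inner_sub_right, inner_add_right, inner_tensor, hc']
    ring
  map_smul' a x := by
    rw [← sub_eq_zero]
    refine eq_zero_of_inner_tensor fun h => ?_
    obtain ⟨c, hc⟩ := exists_kernel_update h f k
    have hc' := hc (h k)
    rw [C0Seq.update_eq_self] at hc'
    simp only [inner_sub_right, inner_smul_right, inner_tensor, hc', RingHom.id_apply]
    ring

theorem slot_apply (f : C0Seq H) (k : ℕ) (x : H k) : slot f k x = tensor (f.update k x) := rfl

theorem slot_self (f : C0Seq H) (k : ℕ) : slot f k (f k) = tensor f := by
  rw [slot_apply, C0Seq.update_eq_self]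

theorem exists_norm_slot_le (f : C0Seq H) (k : ℕ) : ∃ C, ∀ x, ‖slot f k x‖ ≤ C * ‖x‖ := by
  obtain ⟨c, hc⟩ := exists_kernel_update f f k
  refine ⟨Real.sqrt ‖c‖, fun x => ?_⟩
  have h1 : ‖slot f k x‖ ^ 2 = ‖c‖ * ‖x‖ ^ 2 := by
    have h2 : ⟪slot f k x, slot f k x⟫_ℂ = ⟪x, x⟫_ℂ * c := by
      rw [slot_apply, inner_tensor, hc]
    have h3 := congrArg norm h2
    rw [norm_mul, inner_self_eq_norm_sq_to_K, inner_self_eq_norm_sq_to_K] at h3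
    simp only [norm_pow, RCLike.norm_ofReal, abs_norm] at h3
    rw [h3, mul_comm]
  rw [← Real.sqrt_sq (norm_nonneg (slot f k x)), h1, Real.sqrt_mul (norm_nonneg c),
    Real.sqrt_sq (norm_nonneg x)]

theorem continuous_slot (f : C0Seq H) (k : ℕ) : Continuous (slot f k) := by
  obtain ⟨C, hC⟩ := exists_norm_slot_le f k
  exact (LinearMap.mkContinuous (slot f k) C hC).continuous

theorem IsContractionSemigroup.ampl {k : ℕ} {S : ℝ≥0 → H k →L[ℂ] H k}
    (hS : IsContractionSemigroup S) : IsContractionSemigroup fun t => ampl k (S t) where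
  map_zero := by rw [hS.map_zero, ampl_id]
  map_add s t := by rw [hS.map_add, ampl_comp]
  norm_le t := norm_ampl_le_one (hS.norm_le t)
  continuous := by
    -- The vectors with continuous orbit form a closed subspace, since contractivity makes limits
    -- uniform in t; it contains every elementary tensor.
    let N : Submodule ℂ (InfTensor H) :=
      { carrier := {x | Continuous fun t => VonNeumann.ampl k (S t) x}
        zero_mem' := by simpa using continuous_const
        add_mem' := fun {x y} hx hy => 
          (hx.add hy).congr fun t => ((VonNeumann.ampl k (S t)).map_add x y).symm
        smul_mem' := fun c x hx =>
          (hx.const_smul c).congr fun t => ((VonNeumann.ampl k (S t)).map_smul c x).symm }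
    have hN : IsClosed (N : Set (InfTensor H)) := by
      refine isClosed_of_closure_subset fun x hx => ?_
      obtain ⟨u, hu, hlim⟩ := mem_closure_iff_seq_limit.mp hx
      refine (TendstoUniformly.continuous (F := fun n t => VonNeumann.ampl k (S t) (u n)) (p := atTop)
        ?_ (Frequently.of_forall fun n => hu n))
      rw [Metric.tendstoUniformly_iff]
      intro ε hε
      filter_upwards [Metric.tendsto_nhds.mp hlim ε hε] with n hn t
      rw [dist_eq_norm, ← map_sub]
      rw [dist_comm, dist_eq_norm] at hn
      exact (((VonNeumann.ampl k (S t)).le_of_opNorm_le (norm_ampl_le_one (hS.norm_le t)) _).trans_eq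
        (one_mul _)).trans_lt hn
    have hle : (⊤ : Submodule ℂ (InfTensor H)) ≤ N := by
      rw [← topologicalClosure_span_tensor]
      refine Submodule.topologicalClosure_minimal _ (Submodule.span_le.mpr ?_) hN
      rintro _ ⟨f, rfl⟩
      change Continuous fun t => VonNeumann.ampl k (S t) (tensor f)
      simp only [ampl_tensor]
      exact (continuous_slot f k).comp (hS.continuous (f k))
    exact fun x => hle Submodule.mem_top

theorem HasGenerator.ampl {k : ℕ} {S : ℝ≥0 → H k →L[ℂ] H k} {f : C0Seq H} {a : H k}
    (h : HasGenerator S (f k) a) :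
    HasGenerator (fun t => ampl k (S t)) (tensor f) (tensor (f.update k a)) := by
  have h1 := ((continuous_slot f k).tendsto a).comp h
  refine h1.congr fun t => ?_
  simp only [Function.comp_apply, map_smul, map_sub, ampl_tensor, slot_self]
  rfl

/-! ### Finite tensor products of operators -/

/-- The operator with `T i` in the slots `m ≤ i < m + j` and the identity elsewhere. -/
def sliceOp (T : ∀ k, H k →L[ℂ] H k) (m : ℕ) : ℕ → (InfTensor H →L[ℂ] InfTensor H)
  | 0 => ContinuousLinearMap.id ℂ _
  | j + 1 => sliceOp T m j ∘L ampl (m + j) (T (m + j))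

theorem sliceOp_zero_left (T : ∀ k, H k →L[ℂ] H k) (n : ℕ) : sliceOp T 0 n = finTensorOp T n := by
  induction n with
  | zero => rfl
  | succ n ih =>
    rw [sliceOp, finTensorOp, ih, Nat.zero_add]

theorem finTensorOp_add (T : ∀ k, H k →L[ℂ] H k) (m j : ℕ) :
    finTensorOp T (m + j) = finTensorOp T m ∘L sliceOp T m j := by
  induction j with
  | zero => rfl
  | succ j ih => rw [← add_assoc, finTensorOp, ih, sliceOp, ContinuousLinearMap.comp_assoc]

theorem sliceOp_comm_ampl (T : ∀ k, H k →L[ℂ] H k) (m j k : ℕ) (A : H k →L[ℂ] H k)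
    (hk : k < m ∨ m + j ≤ k) : sliceOp T m j ∘L ampl k A = ampl k A ∘L sliceOp T m j := by
  induction j with
  | zero => rfl
  | succ j ih =>
    rw [sliceOp, ContinuousLinearMap.comp_assoc, ampl_comm (by omega),
      ← ContinuousLinearMap.comp_assoc, ih (by omega), ContinuousLinearMap.comp_assoc]

theorem sliceOp_comm_finTensorOp (T B : ∀ k, H k →L[ℂ] H k) (m j n : ℕ) (hn : n ≤ m) :
    sliceOp T m j ∘L finTensorOp B n = finTensorOp B n ∘L sliceOp T m j := by
  induction n with
  | zero => rfl
  | succ n ih =>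
    rw [finTensorOp, ← ContinuousLinearMap.comp_assoc, ih (by omega),
      ContinuousLinearMap.comp_assoc, sliceOp_comm_ampl _ _ _ _ _ (by omega),
      ContinuousLinearMap.comp_assoc]

theorem isContractionSemigroup_sliceOp {S : ∀ k, ℝ≥0 → H k →L[ℂ] H k}
    (hS : ∀ k, IsContractionSemigroup (S k)) (m j : ℕ) :
    IsContractionSemigroup fun t => sliceOp (fun k => S k t) m j := by
  induction j with
  | zero =>
    exact ⟨rfl, fun _ _ => rfl, fun _ => ContinuousLinearMap.norm_id_le, fun _ => continuous_const⟩
  | succ j ih => exact ih.comp (hS _).ampl fun s t => sliceOp_comm_ampl _ _ _ _ _ (by omega)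

theorem isContractionSemigroup_finTensorOp {S : ∀ k, ℝ≥0 → H k →L[ℂ] H k}
    (hS : ∀ k, IsContractionSemigroup (S k)) (n : ℕ) :
    IsContractionSemigroup fun t => finTensorOp (fun k => S k t) n := by
  have h : (fun t => finTensorOp (fun k => S k t) n) = fun t => sliceOp (fun k => S k t) 0 n :=
    funext fun t => (sliceOp_zero_left _ n).symm
  rw [h]
  exact isContractionSemigroup_sliceOp hS 0 n

/-- Iterated product rule. The value is a block of the series in the definition of a strong
convergence vector, so the Cauchy condition on that series controls the slices. -/
theorem hasGenerator_sliceOp {S : ∀ k, ℝ≥0 → H k →L[ℂ] H k}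
    (hS : ∀ k, IsContractionSemigroup (S k)) {f : C0Seq H} {a : ∀ k, H k}
    (ha : ∀ k, HasGenerator (S k) (f k) (a k)) (m j : ℕ) :
    HasGenerator (fun t => sliceOp (fun k => S k t) m j) (tensor f)
      (∑ i ∈ Finset.range j, tensor (f.update (m + i) (a (m + i)))) := by
  induction j with
  | zero => simp [HasGenerator, sliceOp]
  | succ j ih =>
    rw [Finset.sum_range_succ]
    exact ih.comp (isContractionSemigroup_sliceOp hS m j) (ha _).ampl

/-! ### Reduction by the partial tensor products -/

open Classical in
theorem starProjection_tensor (f g : C0Seq H) :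
    (partialTensor g).starProjection (tensor f) = if StrongEquiv f g then tensor f else 0 := by
  split_ifs with h
  · exact Submodule.starProjection_eq_self_iff.mpr (mem_partialTensor h)
  · refine (Submodule.starProjection_apply_eq_zero_iff _).mpr ?_
    rw [partialTensor, Submodule.orthogonal_closure, Submodule.mem_orthogonal]
    intro u hu
    induction hu using Submodule.span_induction with
    | mem x hx =>
      obtain ⟨f', hf', rfl⟩ := hx
      rw [inner_tensor, kernel, if_neg fun e => h (e.symm.trans hf')]
    | zero => simp
    | add x y _ _ hx hy => rw [inner_add_left, hx, hy, add_zero]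
    | smul c x _ hx => rw [inner_smul_left, hx, mul_zero]

/-- Changing one entry does not change the strong equivalence class, so a one-slot operator never
moves an elementary tensor into or out of the subspace. -/
theorem starProjection_comm_ampl (g : C0Seq H) (k : ℕ) (T : H k →L[ℂ] H k) :
    (partialTensor g).starProjection ∘L ampl k T = ampl k T ∘L (partialTensor g).starProjection :=
  ext_tensor fun f => by
    have h : StrongEquiv (f.update k (T (f k))) g ↔ StrongEquiv f g :=
      ⟨(StrongEquiv.update f k _).symm.trans, (StrongEquiv.update f k _).trans⟩
    simp only [ContinuousLinearMap.comp_apply, ampl_tensor, starProjection_tensor]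
    by_cases hf : StrongEquiv f g
    · rw [if_pos hf, if_pos (h.mpr hf), ampl_tensor]
    · rw [if_neg hf, if_neg (mt h.mp hf), map_zero]

theorem starProjection_comm_finTensorOp (g : C0Seq H) (T : ∀ k, H k →L[ℂ] H k) (n : ℕ) :
    (partialTensor g).starProjection ∘L finTensorOp T n =
      finTensorOp T n ∘L (partialTensor g).starProjection := by
  induction n with
  | zero => rfl
  | succ n ih =>
    rw [finTensorOp, ← ContinuousLinearMap.comp_assoc, ih, ContinuousLinearMap.comp_assoc,
      starProjection_comm_ampl, ContinuousLinearMap.comp_assoc]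

theorem reduces_infTensorOp (g : C0Seq H) (T : ∀ k, H k →L[ℂ] H k) :
    Reduces (partialTensor g) (infTensorOp T) := by
  intro x
  have h1 := ((partialTensor g).starProjection.continuous.tendsto _).comp (tendsto_strongLimit x)
  have h2 : Tendsto (fun n => finTensorOp T n ((partialTensor g).starProjection x)) atTop
      (𝓝 ((partialTensor g).starProjection (infTensorOp T x))) :=
    h1.congr fun n => DFunLike.congr_fun (starProjection_comm_finTensorOp g T n) _
  exact ⟨⟨_, h2⟩, strongLimit_eq_of_tendsto h2 _⟩

theorem infTensorOp_mem_partialTensor (g : C0Seq H) (T : ∀ k, H k →L[ℂ] H k)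
    (x : (infTensorOp T).domain) (hx : (x : InfTensor H) ∈ partialTensor g) :
    infTensorOp T x ∈ partialTensor g := by
  obtain ⟨h, hP⟩ := reduces_infTensorOp g T x
  rw [← Submodule.starProjection_eq_self_iff, ← hP]
  congr
  exact Submodule.starProjection_eq_self_iff.mpr hx

/-! ### Strong convergence vectors give contraction semigroups -/

/-- The rank-one operators ⟨g_k, ·⟩f_k send g_k to f_k. No uniform bound on their finite products is
needed. -/
theorem exists_finTensorOp_tendsto {f g : C0Seq H} (hg : ∀ k, ‖g k‖ = 1) (hfg : StrongEquiv f g) :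
    ∃ B : ∀ k, H k →L[ℂ] H k,
      Tendsto (fun n => finTensorOp B n (tensor g)) atTop (𝓝 (tensor f)) := by
  let B : ∀ k, H k →L[ℂ] H k := fun k => (innerSL ℂ (g k)).smulRight (f k)
  have hB : ∀ k, f k = B k (g k) := fun k => by
    simp [B, inner_self_eq_norm_sq_to_K, hg]
  obtain ⟨h, he⟩ := infTensorOp_tensor B g f hB hfg
  refine ⟨B, ?_⟩
  rw [← he]
  exact tendsto_strongLimit ⟨tensor g, h⟩

/-- For N ≤ m ≤ n the prefix operator commutes with the slice from m to n - 1, so the increment of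
the orbit is at most ‖B_N‖ t times the norm of the corresponding block of the series, where B_N is
`finTensorOp B N`. -/
theorem finTensorOp_tensor_mem_uniformCauchyDomain {S : ∀ k, ℝ≥0 → H k →L[ℂ] H k}
    (hS : ∀ k, IsContractionSemigroup (S k)) {g : C0Seq H} {a : ∀ k, H k}
    (ha : ∀ k, HasGenerator (S k) (g k) (a k))
    (hv : CauchySeq fun n => ∑ k ∈ Finset.range n, tensor (g.update k (a k)))
    (B : ∀ k, H k →L[ℂ] H k) (N : ℕ) :
    finTensorOp B N (tensor g) ∈
      uniformCauchyDomain fun n t => finTensorOp (fun k => S k t) n := by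
  have key : ∀ (t : ℝ≥0) (m n : ℕ), N ≤ m → m ≤ n →
      dist (finTensorOp (fun k => S k t) n (finTensorOp B N (tensor g)))
        (finTensorOp (fun k => S k t) m (finTensorOp B N (tensor g))) ≤
      ‖finTensorOp B N‖ * (t * dist (∑ k ∈ Finset.range n, tensor (g.update k (a k)))
        (∑ k ∈ Finset.range m, tensor (g.update k (a k)))) := by
    intro t m n hm hn
    obtain ⟨j, rfl⟩ := Nat.exists_eq_add_of_le hn
    have h1 : sliceOp (fun k => S k t) m j (finTensorOp B N (tensor g)) =
        finTensorOp B N (sliceOp (fun k => S k t) m j (tensor g)) :=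
      DFunLike.congr_fun (sliceOp_comm_finTensorOp _ B m j N hm) _
    rw [finTensorOp_add, ContinuousLinearMap.comp_apply, h1, dist_eq_norm, dist_eq_norm, ← map_sub,
      ← map_sub, Finset.sum_range_add, add_sub_cancel_left]
    refine ((isContractionSemigroup_finTensorOp hS m).norm_apply_le t _).trans ?_
    refine ((finTensorOp B N).le_opNorm _).trans ?_
    exact mul_le_mul_of_nonneg_left ((isContractionSemigroup_sliceOp hS m j).norm_apply_sub_le
      (hasGenerator_sliceOp hS ha m j) t) (norm_nonneg _)
  intro τ
  rw [Metric.uniformCauchySeqOn_iff]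
  intro ε hε
  -- The summand 1 keeps the denominator positive when ‖B_N‖τ = 0.
  obtain ⟨M, hM⟩ := Metric.cauchySeq_iff.mp hv (ε / (‖finTensorOp B N‖ * τ + 1)) (by positivity)
  have key' : ∀ (t : ℝ≥0), t ≤ τ → ∀ (m n : ℕ), N ≤ m → M ≤ m → m ≤ n →
      dist (finTensorOp (fun k => S k t) n (finTensorOp B N (tensor g)))
        (finTensorOp (fun k => S k t) m (finTensorOp B N (tensor g))) < ε := by
    intro t ht m n hNm hMm hmn
    have ht' : (t : ℝ) ≤ τ := ht
    refine (key t m n hNm hmn).trans_lt ?_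
    have h2 := (hM n (hMm.trans hmn) m hMm).le
    rw [← mul_assoc]
    calc _ ≤ (‖finTensorOp B N‖ * τ) * (ε / (‖finTensorOp B N‖ * τ + 1)) := by gcongr
      _ < ε := by
        rw [mul_div_assoc', div_lt_iff₀ (by positivity)]
        linarith
  refine ⟨max N M, fun m hm n hn t ht => ?_⟩
  rcases le_total m n with h | h
  · rw [dist_comm]
    exact key' t ht m n (by omega) (by omega) h
  · exact key' t ht n m (by omega) (by omega) h

theorem partialTensor_le_uniformCauchyDomain {S : ∀ k, ℝ≥0 → H k →L[ℂ] H k}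
    (hS : ∀ k, IsContractionSemigroup (S k)) {g : C0Seq H} (hg : ∀ k, ‖g k‖ = 1) {a : ∀ k, H k}
    (ha : ∀ k, HasGenerator (S k) (g k) (a k))
    (hv : CauchySeq fun n => ∑ k ∈ Finset.range n, tensor (g.update k (a k))) :
    partialTensor g ≤ uniformCauchyDomain fun n t => finTensorOp (fun k => S k t) n := by
  have hcl : IsClosed ((uniformCauchyDomain fun n t => finTensorOp (fun k => S k t) n :
      Submodule ℂ (InfTensor H)) : Set (InfTensor H)) :=
    isClosed_uniformCauchyDomain fun n => (isContractionSemigroup_finTensorOp hS n).norm_le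
  refine Submodule.topologicalClosure_minimal _ (Submodule.span_le.mpr ?_) hcl
  rintro _ ⟨f, hf, rfl⟩
  obtain ⟨B, hB⟩ := exists_finTensorOp_tendsto hg hf
  exact hcl.mem_of_tendsto hB (Eventually.of_forall fun N =>
    finTensorOp_tensor_mem_uniformCauchyDomain hS ha hv B N)

theorem isReducedContractionSemigroup_of_le_uniformCauchyDomain {S : ∀ k, ℝ≥0 → H k →L[ℂ] H k}
    (hS : ∀ k, IsContractionSemigroup (S k)) {g : C0Seq H}
    (hle : partialTensor g ≤ uniformCauchyDomain fun n t => finTensorOp (fun k => S k t) n) :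
    IsReducedContractionSemigroup (partialTensor g) fun t => infTensorOp fun k => S k t := by
  have hT := isContractionSemigroup_finTensorOp hS
  have hdom : ∀ t, partialTensor g ≤ (infTensorOp fun k => S k t).domain := fun t x hx =>
    cauchySeq_tendsto_of_complete ((hle hx t).cauchySeq (Set.mem_Iic.mpr le_rfl))
  refine ⟨fun t => reduces_infTensorOp g _, ?_⟩
  let R₀ : ℝ≥0 → partialTensor g →ₗ[ℂ] partialTensor g := fun t =>
    ((infTensorOp fun k => S k t).toFun ∘ₗ Submodule.inclusion (hdom t)).codRestrict _
      fun x => infTensorOp_mem_partialTensor g _ _ x.2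
  have hR₀ : ∀ t (x : partialTensor g),
      Tendsto (fun n => finTensorOp (fun k => S k t) n x) atTop (𝓝 (R₀ t x : InfTensor H)) :=
    fun t x => tendsto_strongLimit (Submodule.inclusion (hdom t) x)
  have hnorm : ∀ t x, ‖R₀ t x‖ ≤ 1 * ‖x‖ := fun t x => by
    rw [one_mul]
    exact le_of_tendsto (hR₀ t x).norm (Eventually.of_forall fun n => (hT n).norm_apply_le t x)
  refine ⟨fun t => (R₀ t).mkContinuous 1 (hnorm t), ⟨?_, fun s t => ?_, fun t => ?_, fun x => ?_⟩,
    fun t x => ⟨hdom t x.2, rfl⟩⟩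
  · ext x
    refine tendsto_nhds_unique (hR₀ 0 x) ?_
    simp [(hT _).map_zero]
  · ext x
    refine tendsto_nhds_unique (hR₀ (s + t) x) ?_
    change Tendsto _ _ (𝓝 (R₀ s (R₀ t x) : InfTensor H))
    have h1 := hR₀ s (R₀ t x)
    -- Replacing R(t)x by its nth approximation inside the nth contraction costs an error tending to
    -- 0.
    have h2 : Tendsto (fun n => finTensorOp (fun k => S k s) n
        (finTensorOp (fun k => S k t) n x - R₀ t x)) atTop (𝓝 0) := by
      refine squeeze_zero_norm (fun n => (hT n).norm_apply_le s _) ?_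
      simpa using ((hR₀ t x).sub_const (R₀ t x : InfTensor H)).norm
    have h3 := h1.add h2
    rw [add_zero] at h3
    refine h3.congr fun n => ?_
    rw [map_sub, add_sub_cancel, (hT n).map_add]
    rfl
  · exact LinearMap.mkContinuous_norm_le _ zero_le_one _
  · change Continuous fun t => R₀ t x
    rw [continuous_induced_rng]
    refine continuous_iff_continuousAt.mpr fun t => ?_
    -- The interval up to t + 1 is a neighbourhood of t; uniform convergence there transfers
    -- continuity to the limit.
    have hu : TendstoUniformlyOn (fun n s => finTensorOp (fun k => S k s) n x)
        (fun s => (R₀ s x : InfTensor H)) atTop (Set.Iic (t + 1)) :=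
      (hle x.2 (t + 1)).tendstoUniformlyOn_of_tendsto fun s _ => hR₀ s x
    exact (hu.continuousOn (Frequently.of_forall fun n => ((hT n).continuous x).continuousOn)
      ).continuousAt (Iic_mem_nhds (lt_add_one t))

theorem IsStrongConvergenceVector.isReducedContractionSemigroup {S : ∀ k, ℝ≥0 → H k →L[ℂ] H k}
    (hS : ∀ k, IsContractionSemigroup (S k)) {g : C0Seq H}
    (h : IsStrongConvergenceVector (fun k => generator (S k)) g) :
    IsReducedContractionSemigroup (partialTensor g) fun t => infTensorOp fun k => S k t := by
  obtain ⟨hg, hd, v, hv⟩ := h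
  exact isReducedContractionSemigroup_of_le_uniformCauchyDomain hS
    (partialTensor_le_uniformCauchyDomain hS hg (fun k => hasGenerator_generator ⟨g k, hd k⟩)
      hv.cauchySeq)

end Tensor

/-! ### Orbits of contraction semigroups on a Hilbert space -/

section Orbit

variable {E : Type*} [NormedAddCommGroup E]

/-- The orbit of a vector, as a function of a real parameter. -/
def orbit [NormedSpace ℂ E] (S : ℝ≥0 → E →L[ℂ] E) (u : E) (s : ℝ) : E := S s.toNNReal u

section Normed

variable [NormedSpace ℂ E] {S : ℝ≥0 → E →L[ℂ] E}

theorem orbit_coe (S : ℝ≥0 → E →L[ℂ] E) (u : E) (t : ℝ≥0) : orbit S u t = S t u := by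
  simp [orbit]

theorem IsContractionSemigroup.orbit_zero (hS : IsContractionSemigroup S) (u : E) :
    orbit S u 0 = u := by
  simp [orbit, hS.map_zero]

theorem IsContractionSemigroup.continuous_orbit (hS : IsContractionSemigroup S) (u : E) :
    Continuous (orbit S u) :=
  (hS.continuous u).comp continuous_real_toNNReal

theorem IsContractionSemigroup.norm_orbit_le (hS : IsContractionSemigroup S) (u : E) (s : ℝ) :
    ‖orbit S u s‖ ≤ ‖u‖ :=
  hS.norm_apply_le _ u

theorem tendsto_coe_nhdsGT_zero : Tendsto (fun t : ℝ≥0 => (t : ℝ)) (𝓝[>] 0) (𝓝[>] 0) := by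
  refine tendsto_nhdsWithin_iff.mpr ⟨?_, ?_⟩
  · exact (NNReal.continuous_coe.tendsto 0).mono_left nhdsWithin_le_nhds
  · filter_upwards [self_mem_nhdsWithin] with t ht
    exact ht

theorem tendsto_toNNReal_nhdsGT_zero : Tendsto Real.toNNReal (𝓝[>] 0) (𝓝[>] 0) := by
  refine tendsto_nhdsWithin_iff.mpr ⟨?_, ?_⟩
  · have := continuous_real_toNNReal.tendsto 0
    rw [Real.toNNReal_zero] at this
    exact this.mono_left nhdsWithin_le_nhds
  · filter_upwards [self_mem_nhdsWithin] with t ht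
    exact Real.toNNReal_pos.mpr ht

/-- Only right differentiability is claimed: it follows directly from the semigroup law, and it
suffices for the fundamental theorem of calculus. -/
theorem IsContractionSemigroup.hasDerivWithinAt_orbit (hS : IsContractionSemigroup S) {x a : E}
    (ha : HasGenerator S x a) {s : ℝ} (hs : 0 ≤ s) :
    HasDerivWithinAt (orbit S x) (orbit S a s) (Set.Ioi s) s := by
  rw [hasDerivWithinAt_iff_tendsto_slope' (by simp)]
  have h1 := (((S s.toNNReal).continuous.tendsto a).comp ha).comp tendsto_toNNReal_nhdsGT_zero
  have h2 : Tendsto (fun r => r - s) (𝓝[>] s) (𝓝[>] 0) := by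
    refine tendsto_nhdsWithin_iff.mpr ⟨?_, ?_⟩
    · have : Tendsto (fun r => r - s) (𝓝 s) (𝓝 (s - s)) := (continuous_sub_right s).tendsto s
      rw [sub_self] at this
      exact this.mono_left nhdsWithin_le_nhds
    · filter_upwards [self_mem_nhdsWithin] with r hr
      exact Set.mem_Ioi.mpr (sub_pos.mpr (Set.mem_Ioi.mp hr))
  refine (h1.comp h2).congr' ?_
  filter_upwards [self_mem_nhdsWithin] with r hr
  have hr' : 0 ≤ r - s := (sub_pos.mpr (Set.mem_Ioi.mp hr)).le
  have h3 : r.toNNReal = s.toNNReal + (r - s).toNNReal := by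
    rw [← Real.toNNReal_add hs hr', add_sub_cancel]
  simp only [Function.comp_apply, slope_def_module, orbit, h3, hS.map_add,
    ContinuousLinearMap.comp_apply, map_smul, map_sub]
  rw [Real.coe_toNNReal _ hr', ← Complex.ofReal_inv, Complex.coe_smul]

variable [CompleteSpace E]

/-- `orbit` is constant on negative parameters, hence continuous on the whole line, so the
derivative is two-sided even at 0. -/
theorem IsContractionSemigroup.hasDerivAt_integral (hS : IsContractionSemigroup S) (u : E) (s : ℝ) :
    HasDerivAt (fun t => ∫ r in (0 : ℝ)..t, orbit S u r) (orbit S u s) s :=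
  ((hS.continuous_orbit u).integral_hasStrictDerivAt 0 s).hasDerivAt

/-- The integral of an orbit lies in the domain of the generator. -/
theorem IsContractionSemigroup.hasGenerator_integral (hS : IsContractionSemigroup S) (u : E)
    (τ : ℝ≥0) : HasGenerator S (∫ r in (0 : ℝ)..τ, orbit S u r) (S τ u - u) := by
  have hc := hS.continuous_orbit u
  -- Translating the interval of integration by t changes the integral only at its two ends, giving
  -- a slope at τ minus a slope at 0.
  have h1 := (hasDerivAt_iff_tendsto_slope_zero.mp (hS.hasDerivAt_integral u τ)).comp
    (tendsto_coe_nhdsGT_zero.mono_right (nhdsGT_le_nhdsNE 0))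
  have h2 := (hasDerivAt_iff_tendsto_slope_zero.mp (hS.hasDerivAt_integral u 0)).comp
    (tendsto_coe_nhdsGT_zero.mono_right (nhdsGT_le_nhdsNE 0))
  have h3 := h1.sub h2
  rw [orbit_coe, hS.orbit_zero] at h3
  refine h3.congr fun t => ?_
  have h4 : S t (∫ r in (0 : ℝ)..τ, orbit S u r) = ∫ r in (t : ℝ)..(τ + t), orbit S u r := by
    rw [← ContinuousLinearMap.intervalIntegral_comp_comm _ (hc.intervalIntegrable _ _)]
    have h5 := intervalIntegral.integral_comp_add_right (a := 0) (b := τ) (orbit S u) (t : ℝ)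
    rw [zero_add] at h5
    rw [← h5]
    refine intervalIntegral.integral_congr fun r hr => ?_
    rw [Set.uIcc_of_le τ.coe_nonneg] at hr
    have h6 : (r + t).toNNReal = t + r.toNNReal := by
      rw [Real.toNNReal_add hr.1 t.coe_nonneg, Real.toNNReal_coe, add_comm]
    simp [orbit, h6, hS.map_add]
  have h7 := intervalIntegral.integral_add_adjacent_intervals
    (hc.intervalIntegrable (μ := MeasureTheory.volume) 0 (t : ℝ))
    (hc.intervalIntegrable (μ := MeasureTheory.volume) (t : ℝ) (τ + t))
  rw [h4, ← Complex.ofReal_inv, Complex.coe_smul]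
  simp only [Function.comp_apply, zero_add, intervalIntegral.integral_same, sub_zero]
  rw [← smul_sub, ← h7]
  congr 1
  abel

/-- Fills the finitely many slots in which averaging gives no usable bound. If all integrals of an
orbit vanished, differentiating at 0 would give u = 0. -/
theorem IsContractionSemigroup.exists_unit_hasGenerator [Nontrivial E]
    (hS : IsContractionSemigroup S) : ∃ x a : E, ‖x‖ = 1 ∧ HasGenerator S x a := by
  obtain ⟨u, hu⟩ := exists_ne (0 : E)
  have h : ∃ τ : ℝ≥0, ∫ r in (0 : ℝ)..τ, orbit S u r ≠ 0 := by
    by_contra! h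
    have h2 := (hasDerivAt_iff_tendsto_slope_zero.mp (hS.hasDerivAt_integral u 0)).comp
      (tendsto_coe_nhdsGT_zero.mono_right (nhdsGT_le_nhdsNE 0))
    rw [hS.orbit_zero] at h2
    refine hu (tendsto_nhds_unique h2 (tendsto_const_nhds.congr fun t => ?_))
    simp [h]
  obtain ⟨τ, hτ⟩ := h
  refine ⟨_, _, ?_, (hS.hasGenerator_integral u τ).smul
    ((‖∫ r in (0 : ℝ)..τ, orbit S u r‖⁻¹ : ℝ) : ℂ)⟩
  rw [norm_smul, Complex.norm_real, norm_inv, norm_norm, inv_mul_cancel₀ (norm_ne_zero_iff.mpr hτ)]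

end Normed

variable [InnerProductSpace ℂ E]

theorem norm_sub_inner_smul_sq {u : E} (hu : ‖u‖ = 1) (y : E) :
    ‖y - ⟪u, y⟫_ℂ • u‖ ^ 2 = ‖y‖ ^ 2 - ‖⟪u, y⟫_ℂ‖ ^ 2 := by
  have h1 : ⟪u, y - ⟪u, y⟫_ℂ • u⟫_ℂ = 0 := by
    rw [inner_sub_right, inner_smul_right, inner_self_eq_norm_sq_to_K, hu]
    simp
  have h2 : ‖y‖ ^ 2 = ‖⟪u, y⟫_ℂ • u‖ ^ 2 + ‖y - ⟪u, y⟫_ℂ • u‖ ^ 2 := by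
    have := norm_add_sq_eq_norm_sq_add_norm_sq_of_inner_eq_zero (𝕜 := ℂ)
      (⟪u, y⟫_ℂ • u) (y - ⟪u, y⟫_ℂ • u) (by rw [inner_smul_left, h1, mul_zero])
    rw [add_sub_cancel] at this
    simpa only [sq] using this
  rw [h2, norm_smul, hu]
  ring

/-- Since b is orthogonal to u, only the part of w = T*u orthogonal to u counts, and its squared
norm is at most 1 - |⟨u, Tu⟩|². The resulting bound is quadratic in small quantities, hence summable
over slots. -/
theorem norm_inner_apply_le [CompleteSpace E] {u b : E} {T : E →L[ℂ] E} (hT : ‖T‖ ≤ 1)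
    (hu : ‖u‖ = 1) (hb : ⟪u, b⟫_ℂ = 0) :
    ‖⟪u, T b⟫_ℂ‖ ≤ ((1 - ‖⟪u, T u⟫_ℂ‖ ^ 2) + ‖b‖ ^ 2) / 2 := by
  set w := ContinuousLinearMap.adjoint T u with hw
  have h1 : ⟪u, T b⟫_ℂ = ⟪w - ⟪u, w⟫_ℂ • u, b⟫_ℂ := by
    rw [inner_sub_left, inner_smul_left, hb, mul_zero, sub_zero, hw,
      ContinuousLinearMap.adjoint_inner_left]
  have h2 : ‖⟪u, T u⟫_ℂ‖ = ‖⟪u, w⟫_ℂ‖ := by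
    rw [hw, ContinuousLinearMap.adjoint_inner_right, norm_inner_symm]
  have h3 : ‖w‖ ≤ 1 := by
    refine (ContinuousLinearMap.le_opNorm _ _).trans ?_
    rw [hu, mul_one]
    exact ((ContinuousLinearMap.adjoint (𝕜 := ℂ) (E := E) (F := E)).norm_map T).trans_le hT
  have h4 := norm_inner_le_norm (𝕜 := ℂ) (w - ⟪u, w⟫_ℂ • u) b
  have h5 := norm_sub_inner_smul_sq hu w
  rw [h1, h2]
  have h6 : ‖w‖ ^ 2 ≤ 1 := pow_le_one₀ (norm_nonneg _) h3
  nlinarith [sq_nonneg (‖w - ⟪u, w⟫_ℂ • u‖ - ‖b‖)]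

theorem norm_sub_inner_smul_le {u : E} (hu : ‖u‖ = 1) (y : E) (c : ℂ) :
    ‖y - ⟪u, y⟫_ℂ • u‖ ≤ ‖y - c • u‖ := by
  have h := norm_sub_inner_smul_sq hu (y - c • u)
  have h1 : y - c • u - ⟪u, y - c • u⟫_ℂ • u = y - ⟪u, y⟫_ℂ • u := by
    rw [inner_sub_right, inner_smul_right, inner_self_eq_norm_sq_to_K, hu, sub_smul]
    simp
  rw [h1] at h
  refine abs_le_of_sq_le_sq' ?_ (norm_nonneg _) |>.2
  nlinarith [sq_nonneg ‖⟪u, y - c • u⟫_ℂ‖]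

/-- The diagonal matrix coefficient of a semigroup at a vector. -/
def coeff (S : ℝ≥0 → E →L[ℂ] E) (u : E) (s : ℝ) : ℂ := ⟪u, orbit S u s⟫_ℂ

variable {S : ℝ≥0 → E →L[ℂ] E}

theorem IsContractionSemigroup.continuous_coeff (hS : IsContractionSemigroup S) (u : E) :
    Continuous (coeff S u) :=
  continuous_const.inner (hS.continuous_orbit u)

theorem IsContractionSemigroup.norm_coeff_le_one (hS : IsContractionSemigroup S) {u : E}
    (hu : ‖u‖ = 1) (s : ℝ) : ‖coeff S u s‖ ≤ 1 := by
  have h1 := norm_inner_le_norm (𝕜 := ℂ) u (orbit S u s)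
  have h2 := hS.norm_orbit_le u s
  rw [hu] at h1 h2
  rw [one_mul] at h1
  exact h1.trans h2

variable [CompleteSpace E]

/-- Perturbation of the exponential: the matrix coefficient at a unit vector `x` of the domain is
close to `exp (s ⟨x, A x⟩)`. -/
theorem IsContractionSemigroup.norm_exp_mul_coeff_sub_one_le (hS : IsContractionSemigroup S)
    {x a : E} (hx : ‖x‖ = 1) (ha : HasGenerator S x a) {C s : ℝ} (hC : ‖a‖ ≤ C) (hs : 0 ≤ s) :
    ‖Complex.exp (-(s * ⟪x, a⟫_ℂ)) * coeff S x s - 1‖ ≤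
      Real.exp (C * s) * ∫ r in (0 : ℝ)..s,
        ((1 - ‖coeff S x r‖ ^ 2) + ‖a - ⟪x, a⟫_ℂ • x‖ ^ 2) / 2 := by
  set c := ⟪x, a⟫_ℂ with hc
  set b := a - c • x with hb
  have hxx : ⟪x, x⟫_ℂ = 1 := by
    rw [inner_self_eq_norm_sq_to_K, hx]
    simp
  have hxb : ⟪x, b⟫_ℂ = 0 := by
    rw [hb, inner_sub_right, inner_smul_right, hxx, hc, mul_one, sub_self]
  have hcC : ‖c‖ ≤ C := by
    refine ((norm_inner_le_norm (𝕜 := ℂ) x a).trans_eq ?_).trans hC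
    rw [hx, one_mul]
  -- The derivative of exp(-rc)⟨x, S(r)x⟩: with a = b + cx, the c-terms cancel and only b remains.
  let f' : ℝ → ℂ := fun r => Complex.exp (-(r * c)) * ⟪x, orbit S b r⟫_ℂ
  have hexpc : Continuous fun r : ℝ => Complex.exp (-(r * c)) := by fun_prop
  have hf'c : Continuous f' := hexpc.mul (continuous_const.inner (hS.continuous_orbit b))
  have hint : ∫ r in (0 : ℝ)..s, f' r = Complex.exp (-(s * c)) * coeff S x s - 1 := by
    have := intervalIntegral.integral_eq_sub_of_hasDeriv_right (a := 0) (b := s)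
      (f := fun r : ℝ => Complex.exp (-(r * c)) * coeff S x r) (f' := f')
      (hexpc.mul (hS.continuous_coeff x)).continuousOn (fun r hr => ?_)
      (hf'c.intervalIntegrable _ _)
    · rw [this]
      simp only [coeff, hS.orbit_zero, hxx, Complex.ofReal_zero, zero_mul, neg_zero,
        Complex.exp_zero, one_mul]
    · rw [min_eq_left hs] at hr
      have h1 : HasDerivWithinAt (coeff S x) ⟪x, orbit S a r⟫_ℂ (Set.Ioi r) r := by
        have := ((innerSL ℂ x).restrictScalars ℝ).hasFDerivAt.comp_hasDerivWithinAt r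
          (hS.hasDerivWithinAt_orbit ha hr.1.le)
        exact this
      have h2 : HasDerivAt (fun r : ℝ => Complex.exp (-(r * c)))
          (Complex.exp (-(r * c)) * (-c)) r := by
        have h3 : HasDerivAt (fun r : ℝ => -((r : ℂ) * c)) (-(1 * c)) r :=
          ((Complex.ofRealCLM.hasDerivAt (x := r)).mul_const c).neg
        rw [one_mul] at h3
        exact h3.cexp
      refine (h2.hasDerivWithinAt.mul h1).congr_deriv ?_
      have h4 : orbit S a r = orbit S b r + c • orbit S x r := by
        simp [orbit, hb]
      simp only [f', h4, inner_add_right, inner_smul_right, coeff]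
      ring
  rw [← hint, ← intervalIntegral.integral_const_mul]
  refine intervalIntegral.norm_integral_le_of_norm_le hs (Eventually.of_forall fun r hr => ?_) ?_
  · rw [norm_mul, Complex.norm_exp]
    refine mul_le_mul (Real.exp_le_exp.mpr ?_) (norm_inner_apply_le (hS.norm_le _) hx hxb)
      (norm_nonneg _) (Real.exp_pos _).le
    calc (-((r : ℂ) * c)).re ≤ ‖-((r : ℂ) * c)‖ := Complex.re_le_norm _
      _ = r * ‖c‖ := by rw [norm_neg, norm_mul, Complex.norm_real, Real.norm_of_nonneg hr.1.le]
      _ ≤ s * C := mul_le_mul hr.2 hcC (norm_nonneg _) hs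
      _ = C * s := mul_comm _ _
  · have := hS.continuous_coeff x
    exact Continuous.intervalIntegrable (by fun_prop) _ _

/-- Averaging an orbit gives a vector of the domain; its deviation from the initial vector is
controlled by the matrix coefficients. -/
theorem IsContractionSemigroup.exists_hasGenerator_near (hS : IsContractionSemigroup S)
    {u : E} (hu : ‖u‖ = 1) {τ : ℝ≥0} (hτ : 0 < τ) {q : ℝ}
    (hq : (τ : ℝ)⁻¹ * ∫ r in (0 : ℝ)..τ, (1 - ‖coeff S u r‖ ^ 2) = q)
    (hα : 1 / 2 ≤ ‖(τ : ℝ)⁻¹ • ∫ r in (0 : ℝ)..τ, coeff S u r‖) :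
    ∃ x a : E, ‖x‖ = 1 ∧ HasGenerator S x a ∧ ‖1 - ⟪x, u⟫_ℂ‖ ≤ 4 * q ∧ ‖a‖ ≤ 4 / τ ∧
      ‖a - ⟪x, a⟫_ℂ • x‖ ^ 2 ≤ 128 / τ ^ 2 * ((1 - ‖coeff S u τ‖ ^ 2) + q) := by
  have hτ' : (0 : ℝ) < τ := hτ
  have hc := hS.continuous_orbit u
  have huu : ⟪u, u⟫_ℂ = 1 := by
    rw [inner_self_eq_norm_sq_to_K, hu]
    simp
  set m := (τ : ℝ)⁻¹ • ∫ r in (0 : ℝ)..τ, orbit S u r with hm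
  set α := (τ : ℝ)⁻¹ • ∫ r in (0 : ℝ)..τ, coeff S u r with hαdef
  have hmα : ⟪u, m⟫_ℂ = α := by
    have := ContinuousLinearMap.intervalIntegral_comp_comm (innerSL ℂ u)
      (hc.intervalIntegrable (μ := MeasureTheory.volume) 0 τ)
    rw [hm, inner_smul_right_eq_smul, hαdef]
    congr 1
    exact this.symm
  set ξ := m - α • u with hξ
  have hξu : ⟪u, ξ⟫_ℂ = 0 := by
    rw [hξ, inner_sub_right, inner_smul_right, huu, hmα, mul_one, sub_self]
  have hcoeff := hS.continuous_coeff u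
  have hη : ∀ r, ‖orbit S u r - coeff S u r • u‖ ^ 2 ≤ 1 - ‖coeff S u r‖ ^ 2 := fun r => by
    have h1 := norm_sub_inner_smul_sq hu (orbit S u r)
    have h2 := hS.norm_orbit_le u r
    rw [hu] at h2
    have h3 : ‖orbit S u r‖ ^ 2 ≤ 1 := pow_le_one₀ (norm_nonneg _) h2
    rw [coeff, h1]
    linarith
  -- ‖ξ‖² is the average of Re⟨ξ, S(r)u⟩, and S(r)u may be replaced by its part orthogonal to u. The
  -- arithmetic-geometric mean inequality leaves half of ‖ξ‖² to absorb.
  have hξq : ‖ξ‖ ^ 2 ≤ q := by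
    have h1 : ‖ξ‖ ^ 2 = (τ : ℝ)⁻¹ * ∫ r in (0 : ℝ)..τ, (⟪ξ, orbit S u r⟫_ℂ).re := by
      have h2 := ContinuousLinearMap.intervalIntegral_comp_comm (innerSL ℂ ξ)
        (hc.intervalIntegrable (μ := MeasureTheory.volume) 0 τ)
      have h3 := ContinuousLinearMap.intervalIntegral_comp_comm Complex.reCLM
        ((Continuous.inner (𝕜 := ℂ) (continuous_const (y := ξ)) hc).intervalIntegrable
          (μ := MeasureTheory.volume) 0 τ)
      have h4 : ⟪ξ, ξ⟫_ℂ = ⟪ξ, m⟫_ℂ := by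
        conv_lhs => rw [hξ, inner_sub_right, inner_smul_right, ← hξ, inner_eq_zero_symm.mp hξu,
          mul_zero, sub_zero]
      have h5 : (‖ξ‖ ^ 2 : ℝ) = (⟪ξ, ξ⟫_ℂ).re := (inner_self_eq_norm_sq (𝕜 := ℂ) ξ).symm
      rw [h5, h4, hm, inner_smul_right_eq_smul, Complex.smul_re, smul_eq_mul]
      congr 1
      refine Eq.trans ?_ h3.symm
      exact congrArg Complex.re h2.symm
    have h2 : ∫ r in (0 : ℝ)..τ, (⟪ξ, orbit S u r⟫_ℂ).re ≤
        ∫ r in (0 : ℝ)..τ, (‖ξ‖ ^ 2 + (1 - ‖coeff S u r‖ ^ 2)) / 2 := by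
      refine intervalIntegral.integral_mono_on hτ'.le ?_ ?_ fun r _ => ?_
      · exact (Complex.continuous_re.comp (continuous_const.inner hc)).intervalIntegrable _ _
      · exact Continuous.intervalIntegrable (by fun_prop) _ _
      · have h3 : ⟪ξ, orbit S u r⟫_ℂ = ⟪ξ, orbit S u r - coeff S u r • u⟫_ℂ := by
          rw [inner_sub_right, inner_smul_right, inner_eq_zero_symm.mp hξu, mul_zero, sub_zero]
        have h4 := (Complex.re_le_norm _).trans
          (norm_inner_le_norm (𝕜 := ℂ) ξ (orbit S u r - coeff S u r • u))
        rw [h3]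
        nlinarith [sq_nonneg (‖ξ‖ - ‖orbit S u r - coeff S u r • u‖), hη r]
    have h3 : ∫ r in (0 : ℝ)..τ, (‖ξ‖ ^ 2 + (1 - ‖coeff S u r‖ ^ 2)) / 2 =
        (τ * ‖ξ‖ ^ 2 + ∫ r in (0 : ℝ)..τ, (1 - ‖coeff S u r‖ ^ 2)) / 2 := by
      rw [intervalIntegral.integral_div, intervalIntegral.integral_add
        (continuous_const.intervalIntegrable _ _)
        (Continuous.intervalIntegrable (by fun_prop) _ _)]
      simp
    have h4 : (τ : ℝ)⁻¹ * ∫ r in (0 : ℝ)..τ, (⟪ξ, orbit S u r⟫_ℂ).re ≤ (‖ξ‖ ^ 2 + q) / 2 := by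
      refine (mul_le_mul_of_nonneg_left (h2.trans_eq h3) (inv_nonneg.mpr hτ'.le)).trans_eq ?_
      rw [← hq]
      field_simp
    linarith
  have hα0 : α ≠ 0 := fun h => by
    rw [h, norm_zero] at hα
    norm_num at hα
  -- This scaling makes the u-component of y equal to 1, so that ‖y‖ differs from 1 only to second
  -- order in ξ.
  set y := α⁻¹ • m with hy
  set w := (α⁻¹ * ((τ : ℝ) : ℂ)⁻¹) • (S τ u - u) with hw
  have hyw : HasGenerator S y w := by
    have := (hS.hasGenerator_integral u τ).smul (α⁻¹ * ((τ : ℝ) : ℂ)⁻¹)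
    rwa [mul_smul, ← Complex.ofReal_inv, Complex.coe_smul, Complex.ofReal_inv] at this
  have hyu : y = u + α⁻¹ • ξ := by
    rw [hy, hξ, smul_sub, inv_smul_smul₀ hα0, add_sub_cancel]
  have hαinv : ‖α⁻¹‖ ≤ 2 := by
    rw [norm_inv]
    exact inv_le_of_inv_le₀ (by norm_num) (by linarith)
  have hζ : ‖α⁻¹ • ξ‖ ≤ 2 * ‖ξ‖ := by
    rw [norm_smul]
    exact mul_le_mul_of_nonneg_right hαinv (norm_nonneg _)
  have hynorm : ‖y‖ ^ 2 = 1 + ‖α⁻¹ • ξ‖ ^ 2 := by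
    have := norm_add_sq_eq_norm_sq_add_norm_sq_of_inner_eq_zero (𝕜 := ℂ) u (α⁻¹ • ξ)
      (by rw [inner_smul_right, hξu, mul_zero])
    rw [← hyu, hu] at this
    nlinarith
  have hy1 : 1 ≤ ‖y‖ := by
    nlinarith [norm_nonneg y, sq_nonneg ‖α⁻¹ • ξ‖]
  have hypos : 0 < ‖y‖ := by linarith
  have hyinv : ‖((‖y‖⁻¹ : ℝ) : ℂ)‖ ≤ 1 := by
    rw [Complex.norm_real, norm_inv, norm_norm]
    exact inv_le_one_of_one_le₀ hy1
  have hSu : ‖S τ u - u‖ ≤ 2 := by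
    have h1 := norm_sub_le (S τ u) u
    have h2 := hS.norm_apply_le τ u
    linarith
  have hcoefτ : ‖α⁻¹ * ((τ : ℝ) : ℂ)⁻¹‖ ≤ 2 / τ := by
    rw [norm_mul, norm_inv ((τ : ℝ) : ℂ), Complex.norm_real, Real.norm_of_nonneg hτ'.le,
      div_eq_mul_inv]
    exact mul_le_mul_of_nonneg_right hαinv (inv_nonneg.mpr hτ'.le)
  have hw4 : ‖w‖ ≤ 4 / τ := by
    rw [hw, norm_smul]
    refine (mul_le_mul hcoefτ hSu (norm_nonneg _) (by positivity)).trans_eq ?_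
    ring
  have hx1 : ‖((‖y‖⁻¹ : ℝ) : ℂ) • y‖ = 1 := by
    rw [norm_smul, Complex.norm_real, norm_inv, norm_norm, inv_mul_cancel₀ hypos.ne']
  refine ⟨((‖y‖⁻¹ : ℝ) : ℂ) • y, ((‖y‖⁻¹ : ℝ) : ℂ) • w, hx1, hyw.smul _, ?_, ?_, ?_⟩
  · have h1 : ⟪y, u⟫_ℂ = 1 := by
      rw [hyu, inner_add_left, inner_smul_left, inner_eq_zero_symm.mp hξu, huu, mul_zero, add_zero]
    rw [inner_smul_left, h1, mul_one, Complex.conj_ofReal, ← Complex.ofReal_one,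
      ← Complex.ofReal_sub, Complex.norm_real, Real.norm_of_nonneg
        (sub_nonneg.mpr (inv_le_one_of_one_le₀ hy1))]
    have h2 : 1 - ‖y‖⁻¹ ≤ ‖y‖ ^ 2 - 1 := by
      have h3 : 1 - ‖y‖⁻¹ ≤ ‖y‖ - 1 := by
        have h4 : ‖y‖ * ‖y‖⁻¹ = 1 := mul_inv_cancel₀ hypos.ne'
        have h5 : 0 < ‖y‖⁻¹ := inv_pos.mpr hypos
        nlinarith [sq_nonneg (‖y‖ - 1)]
      nlinarith
    have h3 : ‖α⁻¹ • ξ‖ ^ 2 ≤ (2 * ‖ξ‖) ^ 2 := pow_le_pow_left₀ (norm_nonneg _) hζ 2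
    nlinarith
  · rw [norm_smul]
    exact (mul_le_mul hyinv hw4 (norm_nonneg _) zero_le_one).trans_eq (one_mul _)
  -- This z matches the u-components of w and zy. The true expectation is the best scalar, so any z
  -- gives an upper bound for the deviation.
  · set z := α⁻¹ * ((τ : ℝ) : ℂ)⁻¹ * (coeff S u τ - 1) with hz
    have hcτ : coeff S u τ = ⟪u, S τ u⟫_ℂ := by rw [coeff, orbit_coe]
    have h1 : w - z • y =
        (α⁻¹ * ((τ : ℝ) : ℂ)⁻¹) • (S τ u - coeff S u τ • u) - z • α⁻¹ • ξ := by
      rw [hyu, hz, hw]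
      module
    have h2 : ‖z‖ ≤ 4 / τ := by
      have h3 : ‖coeff S u τ - 1‖ ≤ 2 := by
        have h4 := norm_sub_le (coeff S u τ) 1
        have h5 := hS.norm_coeff_le_one hu τ
        rw [norm_one] at h4
        linarith
      rw [hz, norm_mul]
      refine (mul_le_mul hcoefτ h3 (norm_nonneg _) (by positivity)).trans_eq ?_
      ring
    have h3 : ‖w - z • y‖ ≤ 2 / τ * ‖S τ u - coeff S u τ • u‖ + 4 / τ * (2 * ‖ξ‖) := by
      rw [h1]
      refine (norm_sub_le _ _).trans (add_le_add ?_ ?_)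
      · rw [norm_smul]
        exact mul_le_mul_of_nonneg_right hcoefτ (norm_nonneg _)
      · rw [norm_smul]
        exact mul_le_mul h2 hζ (norm_nonneg _) (by positivity)
    have h4 := norm_sub_inner_smul_le hx1 (((‖y‖⁻¹ : ℝ) : ℂ) • w) z
    have h5 : ‖((‖y‖⁻¹ : ℝ) : ℂ) • w - z • ((‖y‖⁻¹ : ℝ) : ℂ) • y‖ ≤ ‖w - z • y‖ := by
      rw [smul_comm z, ← smul_sub, norm_smul]
      exact mul_le_of_le_one_left (norm_nonneg _) hyinv
    have h6 := pow_le_pow_left₀ (norm_nonneg _) (h4.trans (h5.trans h3)) 2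
    refine h6.trans ?_
    have h7 := hη τ
    rw [orbit_coe] at h7
    have h8 : (2 / τ * ‖S τ u - coeff S u τ • u‖ + 4 / τ * (2 * ‖ξ‖)) ^ 2 =
        (4 / (τ : ℝ) ^ 2) * (‖S τ u - coeff S u τ • u‖ + 4 * ‖ξ‖) ^ 2 := by
      field_simp
      ring
    -- From (p + 4r)² ≤ 2p² + 32r²; with the prefactor 4/τ² this gives the constant 128.
    have h9 : (‖S τ u - coeff S u τ • u‖ + 4 * ‖ξ‖) ^ 2 ≤
        32 * ((1 - ‖coeff S u τ‖ ^ 2) + q) := by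
      nlinarith [sq_nonneg (‖S τ u - coeff S u τ • u‖ - 4 * ‖ξ‖),
        sq_nonneg ‖S τ u - coeff S u τ • u‖]
    rw [h8]
    refine (mul_le_mul_of_nonneg_left h9 (by positivity)).trans_eq ?_
    ring

end Orbit

/-! ### Two convergence criteria -/

/-- A sequence converges if its exponentials `exp (-s σ)` do, for all small `s`. -/
theorem cauchySeq_of_tendsto_exp {σ : ℕ → ℂ} {δ : ℝ} (hδ : 0 < δ)
    (h : ∀ s : ℝ, 0 ≤ s → s ≤ δ → ∃ L : ℂ, L ≠ 0 ∧
      Tendsto (fun n => Complex.exp (-(s * σ n))) atTop (𝓝 L)) : CauchySeq σ := by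
  rw [cauchySeq_iff_tendsto_dist_atTop_0]
  let ν : ℕ × ℕ → ℂ := fun p => σ p.1 - σ p.2
  have hν : ∀ s : ℝ, 0 ≤ s → s ≤ δ →
      Tendsto (fun p => Complex.exp (-(s * ν p))) atTop (𝓝 1) := by
    intro s h0 h1
    obtain ⟨L, hL, hlim⟩ := h s h0 h1
    rw [← prod_atTop_atTop_eq]
    have h2 := (hlim.comp tendsto_fst).div (hlim.comp (tendsto_snd (f := (atTop : Filter ℕ)))) hL
    rw [div_self hL] at h2
    refine h2.congr fun p => ?_
    simp only [ν]
    change Complex.exp _ / Complex.exp _ = _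
    rw [← Complex.exp_sub]
    congr 1
    ring
  -- The modulus of exp(-sν) is monotone in s, so its values at 0 and δ bound it in between.
  have hbd : ∀ᶠ p in (atTop : Filter (ℕ × ℕ)), ∀ s : ℝ, 0 ≤ s → s ≤ δ →
      ‖Complex.exp (-(s * ν p))‖ ≤ 2 := by
    have h1 : ∀ᶠ p in (atTop : Filter (ℕ × ℕ)), ‖Complex.exp (-(δ * ν p))‖ < 2 :=
      (hν δ hδ.le le_rfl).norm.eventually_lt_const (by simp)
    filter_upwards [h1] with p hp s h0 hs
    rw [Complex.norm_exp] at hp ⊢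
    have e1 : ∀ r : ℝ, (-((r : ℂ) * ν p)).re = r * (-(ν p).re) := fun r => by simp
    rw [e1] at hp ⊢
    rcases le_total (-(ν p).re) 0 with hneg | hpos
    · refine (Real.exp_le_one_iff.mpr (mul_nonpos_of_nonneg_of_nonpos h0 hneg)).trans one_le_two
    · exact (Real.exp_le_exp.mpr (mul_le_mul_of_nonneg_right hs hpos)).trans hp.le
  -- A single s > 0 determines ν only modulo 2πi/s. Integrating over s removes the ambiguity: ν
  -- times the integral is 1 - exp(-δν), and the integral tends to δ ≠ 0.
  have hI : Tendsto (fun p => ∫ s in (0 : ℝ)..δ, Complex.exp (-(s * ν p))) atTop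
      (𝓝 (∫ _ in (0 : ℝ)..δ, (1 : ℂ))) := by
    refine intervalIntegral.tendsto_integral_filter_of_dominated_convergence (fun _ => 2) ?_ ?_
      (continuous_const.intervalIntegrable _ _) ?_
    · exact Eventually.of_forall fun p =>
        (Continuous.aestronglyMeasurable (by fun_prop))
    · filter_upwards [hbd] with p hp
      refine Eventually.of_forall fun s hs => ?_
      rw [Set.uIoc_of_le hδ.le] at hs
      exact hp s hs.1.le hs.2
    · refine Eventually.of_forall fun s hs => ?_
      rw [Set.uIoc_of_le hδ.le] at hs
      exact hν s hs.1.le hs.2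
  have hI' : ∫ _ in (0 : ℝ)..δ, (1 : ℂ) = δ := by simp
  rw [hI'] at hI
  have hδ' : (δ : ℂ) ≠ 0 := Complex.ofReal_ne_zero.mpr hδ.ne'
  have hmul : ∀ p, ν p * ∫ s in (0 : ℝ)..δ, Complex.exp (-(s * ν p)) =
      1 - Complex.exp (-(δ * ν p)) := by
    intro p
    rcases eq_or_ne (ν p) 0 with h0 | h0
    · simp [h0]
    · have := integral_exp_mul_complex (a := 0) (b := δ) (neg_ne_zero.mpr h0)
      have e : ∀ s : ℝ, -((s : ℂ) * ν p) = -ν p * s := fun s => by ring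
      simp only [e]
      rw [this]
      field_simp
      simp
  have hlim := (tendsto_const_nhds (x := (1 : ℂ)) |>.sub (hν δ hδ.le le_rfl)).div hI hδ'
  rw [sub_self, zero_div] at hlim
  have hν0 : Tendsto ν atTop (𝓝 0) := by
    refine hlim.congr' ?_
    filter_upwards [hI.eventually_ne hδ'] with p hp
    simp only [Pi.div_apply]
    rw [← hmul, mul_div_cancel_right₀ _ hp]
  simpa [ν, dist_eq_norm] using hν0.norm

theorem summable_of_orthogonal {E : Type*} [NormedAddCommGroup E] [InnerProductSpace ℂ E]
    [CompleteSpace E] {ι : Type*} {v : ι → E} (hv : Pairwise fun i j => ⟪v i, v j⟫_ℂ = 0)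
    (hs : Summable fun i => ‖v i‖ ^ 2) : Summable v := by
  have hV : OrthogonalFamily ℂ (fun i => (ℂ ∙ v i : Submodule ℂ E))
      fun i => (ℂ ∙ v i : Submodule ℂ E).subtypeₗᵢ :=
    OrthogonalFamily.of_pairwise fun i j hij => by
      simpa [Function.onFun, Submodule.isOrtho_span] using hv hij
  exact (hV.summable_iff_norm_sq_summable
    fun i => ⟨v i, Submodule.mem_span_singleton_self _⟩).mpr hs

/-! ### From a semigroup on a partial tensor product to a strong convergence vector -/

section Converse

variable {H : ℕ → Type u} [∀ i, NormedAddCommGroup (H i)] [∀ i, InnerProductSpace ℂ (H i)]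

theorem inner_self_of_norm_eq_one {E : Type*} [NormedAddCommGroup E] [InnerProductSpace ℂ E]
    {x : E} (hx : ‖x‖ = 1) : ⟪x, x⟫_ℂ = 1 := by
  rw [inner_self_eq_norm_sq_to_K, hx]
  simp

theorem kernel_self {f : C0Seq H} (hf : ∀ k, ‖f k‖ = 1) : kernel f f = 1 := by
  simp only [kernel, StrongEquiv.refl, if_true, inner_self_of_norm_eq_one (hf _), tprod_one]

theorem inner_tensor_finTensorOp {f : C0Seq H} (hf : ∀ k, ‖f k‖ = 1) (T : ∀ k, H k →L[ℂ] H k)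
    (n : ℕ) : ⟪tensor f, finTensorOp T n (tensor f)⟫_ℂ =
      ∏ k ∈ Finset.range n, ⟪f k, T k (f k)⟫_ℂ := by
  have h : StrongEquiv f (C0Seq.mapLt T n f) := by
    refine (summable_congr_cofinite ?_).mpr (StrongEquiv.refl f)
    filter_upwards [(Finset.range n).finite_toSet.compl_mem_cofinite] with i hi
    have : ¬ i < n := by simpa using hi
    rw [C0Seq.mapLt_apply, if_neg this]
  rw [finTensorOp_tensor, inner_tensor, kernel, if_pos h, tprod_eq_prod (s := Finset.range n)]
  · refine Finset.prod_congr rfl fun i hi => ?_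
    rw [C0Seq.mapLt_apply, if_pos (Finset.mem_range.mp hi)]
  · intro i hi
    rw [C0Seq.mapLt_apply, if_neg (by simpa using hi), inner_self_of_norm_eq_one (hf i)]

theorem norm_slot {f : C0Seq H} (hf : ∀ k, ‖f k‖ = 1) (k : ℕ) (x : H k) : ‖slot f k x‖ = ‖x‖ := by
  obtain ⟨c, hc⟩ := exists_kernel_update f f k
  have h1 : c = 1 := by
    have := hc (f k) (f k)
    rw [C0Seq.update_eq_self, kernel_self hf, inner_self_of_norm_eq_one (hf k), one_mul] at this
    exact this.symm
  have h2 : ⟪slot f k x, slot f k x⟫_ℂ = ⟪x, x⟫_ℂ := by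
    rw [slot_apply, inner_tensor, hc, h1, mul_one]
  rw [@norm_eq_sqrt_re_inner ℂ _ _ _ _ (slot f k x), h2, ← norm_eq_sqrt_re_inner]

theorem inner_slot_eq_zero {f : C0Seq H} {j k : ℕ} (hjk : j ≠ k) (x : H j) {y : H k}
    (hy : ⟪f k, y⟫_ℂ = 0) : ⟪slot f j x, slot f k y⟫_ℂ = 0 := by
  rw [slot_apply, slot_apply, inner_tensor, kernel]
  split_ifs
  · refine tprod_of_exists_eq_zero ⟨k, ?_⟩
    rw [f.update_of_ne _ hjk.symm, f.update_self, hy]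
  · rfl

/-- A sequence of unit vectors is a strong convergence vector as soon as the expectations of the
generators have a convergent series and their deviations are square summable. -/
theorem cauchySeq_sum_tensor_update {f : C0Seq H} (hf : ∀ k, ‖f k‖ = 1) {a : ∀ k, H k}
    (hσ : CauchySeq fun n => ∑ k ∈ Finset.range n, ⟪f k, a k⟫_ℂ)
    (hb : Summable fun k => ‖a k - ⟪f k, a k⟫_ℂ • f k‖ ^ 2) :
    CauchySeq fun n => ∑ k ∈ Finset.range n, tensor (f.update k (a k)) := by
  -- With a_k split along f_k, the parallel parts are multiples of one fixed tensor, and the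
  -- remaining parts give pairwise orthogonal tensors.
  have h1 : Summable fun k => slot f k (a k - ⟪f k, a k⟫_ℂ • f k) := by
    refine summable_of_orthogonal (fun j k hjk => inner_slot_eq_zero hjk _ ?_) ?_
    · rw [inner_sub_right, inner_smul_right, inner_self_of_norm_eq_one (hf k), mul_one, sub_self]
    · simpa only [norm_slot hf] using hb
  obtain ⟨c, hc⟩ := cauchySeq_tendsto_of_complete hσ
  have h2 := (hc.smul_const (tensor f)).add h1.hasSum.tendsto_sum_nat
  refine (h2.congr fun n => ?_).cauchySeq
  rw [Finset.sum_smul, ← Finset.sum_add_distrib]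
  refine Finset.sum_congr rfl fun k _ => ?_
  rw [map_sub, map_smul, slot_self, add_sub_cancel, slot_apply]

/-- Normalize the nonzero entries. A zero entry may become any unit vector, since it already costs 1
in the `C0Seq` sum. -/
theorem exists_unit_strongEquiv [∀ k, Nontrivial (H k)] (g : C0Seq H) :
    ∃ g' : C0Seq H, (∀ k, ‖g' k‖ = 1) ∧ StrongEquiv g' g := by
  have h : ∀ k, ∃ x : H k, ‖x‖ = 1 ∧ ‖1 - ⟪x, g k⟫_ℂ‖ ≤ |1 - ‖g k‖| := by
    intro k
    rcases eq_or_ne (g k) 0 with h0 | h0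
    · obtain ⟨u, hu⟩ := exists_ne (0 : H k)
      refine ⟨((‖u‖⁻¹ : ℝ) : ℂ) • u, ?_, by simp [h0]⟩
      rw [norm_smul, Complex.norm_real, norm_inv, norm_norm,
        inv_mul_cancel₀ (norm_ne_zero_iff.mpr hu)]
    · have hn := norm_ne_zero_iff.mpr h0
      refine ⟨((‖g k‖⁻¹ : ℝ) : ℂ) • g k, ?_, le_of_eq ?_⟩
      · rw [norm_smul, Complex.norm_real, norm_inv, norm_norm, inv_mul_cancel₀ hn]
      · have h1 : ⟪g k, g k⟫_ℂ = ((‖g k‖ ^ 2 : ℝ) : ℂ) := by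
          rw [inner_self_eq_norm_sq_to_K]
          push_cast
          rfl
        have h2 : ‖g k‖⁻¹ * ‖g k‖ ^ 2 = ‖g k‖ := by field_simp
        rw [inner_smul_left, Complex.conj_ofReal, h1, ← Complex.ofReal_mul, h2,
          ← Complex.ofReal_one, ← Complex.ofReal_sub, Complex.norm_real, Real.norm_eq_abs]
  choose x hx hxg using h
  exact ⟨⟨x, by simp [hx]⟩, hx, g.summable'.of_nonneg_of_le (fun _ => norm_nonneg _) hxg⟩

/-- From p ≤ exp(-(1 - p)) and exp(-1) < 1/2, the sum of the 1 - p_k is at most 1; then 1 - p² ≤ 2(1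
- p). -/
theorem sum_one_sub_sq_le_two {p : ℕ → ℝ} (h0 : ∀ k, 0 ≤ p k) {n : ℕ}
    (h : 1 / 2 ≤ ∏ k ∈ Finset.range n, p k) : ∑ k ∈ Finset.range n, (1 - p k ^ 2) ≤ 2 := by
  have h2 : ∏ k ∈ Finset.range n, p k ≤ Real.exp (-∑ k ∈ Finset.range n, (1 - p k)) := by
    rw [← Finset.sum_neg_distrib, Real.exp_sum]
    refine Finset.prod_le_prod (fun k _ => h0 k) fun k _ => ?_
    have := Real.add_one_le_exp (-(1 - p k))
    linarith
  have h3 : ∑ k ∈ Finset.range n, (1 - p k) ≤ 1 := by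
    by_contra hlt
    rw [not_le] at hlt
    have h4 : Real.exp (-∑ k ∈ Finset.range n, (1 - p k)) ≤ Real.exp (-1) :=
      Real.exp_le_exp.mpr (neg_le_neg hlt.le)
    have h5 : Real.exp (-1) < 1 / 2 := by
      rw [Real.exp_neg, one_div]
      exact inv_strictAnti₀ two_pos (by linarith [Real.exp_one_gt_d9])
    linarith
  calc ∑ k ∈ Finset.range n, (1 - p k ^ 2) ≤ ∑ k ∈ Finset.range n, 2 * (1 - p k) :=
        Finset.sum_le_sum fun k _ => by nlinarith [sq_nonneg (1 - p k)]
    _ = 2 * ∑ k ∈ Finset.range n, (1 - p k) := by rw [Finset.mul_sum]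
    _ ≤ 2 := by linarith

/-- On the partial tensor products where the infinite product is a semigroup, the products of the
matrix coefficients converge to a nonzero value for small times. -/
theorem IsReducedContractionSemigroup.exists_coeff {S : ∀ k, ℝ≥0 → H k →L[ℂ] H k}
    (hS : ∀ k, IsContractionSemigroup (S k)) {g : C0Seq H}
    (h : IsReducedContractionSemigroup (partialTensor g) fun t => infTensorOp fun k => S k t)
    {f : C0Seq H} (hf : ∀ k, ‖f k‖ = 1) (hfg : StrongEquiv f g) :
    ∃ δ : ℝ≥0, 0 < δ ∧ ∀ s : ℝ, 0 ≤ s → s ≤ δ →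
      (∃ c : ℂ, c ≠ 0 ∧
        Tendsto (fun n => ∏ k ∈ Finset.range n, coeff (S k) (f k) s) atTop (𝓝 c)) ∧
      ∀ n, ∑ k ∈ Finset.range n, (1 - ‖coeff (S k) (f k) s‖ ^ 2) ≤ 2 := by
  obtain ⟨-, R, hR, hRS⟩ := h
  let x : partialTensor g := ⟨tensor f, mem_partialTensor hfg⟩
  let c : ℝ≥0 → ℂ := fun t => ⟪tensor f, (R t x : InfTensor H)⟫_ℂ
  have hc : Continuous c := continuous_const.inner (continuous_subtype_val.comp (hR.continuous x))
  have hc0 : c 0 = 1 := by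
    simp only [c, hR.map_zero, ContinuousLinearMap.id_apply, x]
    rw [inner_tensor, kernel_self hf]
  have hlim : ∀ t : ℝ≥0,
      Tendsto (fun n => ∏ k ∈ Finset.range n, coeff (S k) (f k) t) atTop (𝓝 (c t)) := by
    intro t
    obtain ⟨hd, he⟩ := hRS t x
    have h1 := tendsto_strongLimit (l := atTop) (L := finTensorOp fun k => S k t) ⟨x, hd⟩
    have h2 : Tendsto (fun n => ⟪tensor f, finTensorOp (fun k => S k t) n (tensor f)⟫_ℂ) atTop
        (𝓝 (c t)) := by
      simp only [c, ← he]
      exact tendsto_const_nhds.inner h1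
    refine h2.congr fun n => ?_
    rw [inner_tensor_finTensorOp hf]
    simp only [coeff, orbit_coe]
  have hev : ∀ᶠ t in 𝓝 (0 : ℝ≥0), 1 / 2 < ‖c t‖ := by
    refine hc.norm.continuousAt.eventually_const_lt ?_
    simp only [hc0]
    norm_num
  obtain ⟨δ, hδ, hball⟩ := Metric.nhds_basis_closedBall.eventually_iff.mp hev
  refine ⟨⟨δ, hδ.le⟩, hδ, fun s h0 hs => ?_⟩
  lift s to ℝ≥0 using h0
  have hcs : 1 / 2 < ‖c s‖ := by
    refine hball ?_
    rw [Metric.mem_closedBall, NNReal.dist_eq]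
    rw [NNReal.coe_zero, sub_zero, abs_of_nonneg s.coe_nonneg]
    exact hs
  refine ⟨⟨c s, norm_pos_iff.mp (by linarith), hlim s⟩, fun n => ?_⟩
  have hle : ∀ k, ‖coeff (S k) (f k) s‖ ≤ 1 := fun k => (hS k).norm_coeff_le_one (hf k) _
  refine sum_one_sub_sq_le_two (fun k => norm_nonneg _) (hcs.le.trans ?_)
  -- The moduli are at most 1, so every partial product dominates the limit, which exceeds 1/2.
  have hanti : Antitone fun n => ∏ k ∈ Finset.range n, ‖coeff (S k) (f k) s‖ :=
    antitone_nat_of_succ_le fun n => by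
      rw [Finset.prod_range_succ]
      exact mul_le_of_le_one_right (Finset.prod_nonneg fun k _ => norm_nonneg _) (hle n)
  have hl := (hlim s).norm
  simp only [norm_prod] at hl
  exact hanti.le_of_tendsto hl n

theorem tendsto_one_of_tendsto_prod {z : ℕ → ℂ} {c : ℂ} (hc : c ≠ 0)
    (h : Tendsto (fun n => ∏ k ∈ Finset.range n, z k) atTop (𝓝 c)) :
    Tendsto z atTop (𝓝 1) := by
  have h1 := (h.comp (tendsto_add_atTop_nat 1)).div h hc
  rw [div_self hc] at h1
  refine h1.congr' ?_
  filter_upwards [h.eventually_ne hc] with n hn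
  simp only [Pi.div_apply, Function.comp_apply]
  rw [Finset.prod_range_succ, mul_div_cancel_left₀ _ hn]

variable [∀ k, CompleteSpace (H k)]

/-- A regularization of a sequence of unit vectors, entrywise in the domains of the generators. -/
theorem exists_regularization [∀ k, Nontrivial (H k)] {S : ∀ k, ℝ≥0 → H k →L[ℂ] H k}
    (hS : ∀ k, IsContractionSemigroup (S k)) {g : C0Seq H} (hg : ∀ k, ‖g k‖ = 1) {τ : ℝ≥0}
    (hτ : 0 < τ)
    (hlim : ∀ s : ℝ, 0 ≤ s → s ≤ τ → Tendsto (fun k => coeff (S k) (g k) s) atTop (𝓝 1))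
    (hsum : ∀ s : ℝ, 0 ≤ s → s ≤ τ →
      ∀ n, ∑ k ∈ Finset.range n, (1 - ‖coeff (S k) (g k) s‖ ^ 2) ≤ 2) :
    ∃ (f : C0Seq H) (a : ∀ k, H k) (C : ℝ), (∀ k, ‖f k‖ = 1) ∧ StrongEquiv f g ∧
      (∀ k, HasGenerator (S k) (f k) (a k)) ∧ (∀ k, ‖a k‖ ≤ C) ∧
      Summable fun k => ‖a k - ⟪f k, a k⟫_ℂ • f k‖ ^ 2 := by
  have hτ' : (0 : ℝ) < τ := hτ
  have hcont := fun k => (hS k).continuous_coeff (g k)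
  have hnn : ∀ k (s : ℝ), 0 ≤ 1 - ‖coeff (S k) (g k) s‖ ^ 2 := fun k s =>
    sub_nonneg.mpr (pow_le_one₀ (norm_nonneg _) ((hS k).norm_coeff_le_one (hg k) s))
  -- q_k averages the deficiency 1 - |φ_k|² over [0, τ]; averaging the uniform bound on partial sums
  -- makes q summable.
  set q : ℕ → ℝ := fun k => (τ : ℝ)⁻¹ * ∫ r in (0 : ℝ)..τ, (1 - ‖coeff (S k) (g k) r‖ ^ 2) with hq
  have hqs : Summable q := by
    refine summable_of_sum_range_le (c := 2) (fun k => ?_) fun n => ?_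
    · exact mul_nonneg (inv_nonneg.mpr hτ'.le)
        (intervalIntegral.integral_nonneg hτ'.le fun r _ => hnn k r)
    · have h1 : ∀ k, Continuous fun r => 1 - ‖coeff (S k) (g k) r‖ ^ 2 := fun k => by
        have := hcont k
        fun_prop
      rw [hq, ← Finset.mul_sum, ← intervalIntegral.integral_finsetSum
        fun k _ => (h1 k).intervalIntegrable _ _]
      have h2 := intervalIntegral.integral_mono_on (μ := MeasureTheory.volume) hτ'.le
        ((continuous_finsetSum (Finset.range n) fun k _ => h1 k).intervalIntegrable _ _)
        (continuous_const.intervalIntegrable _ _) fun r hr => hsum r hr.1 hr.2 n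
      refine (mul_le_mul_of_nonneg_left h2 (inv_nonneg.mpr hτ'.le)).trans_eq ?_
      simp
      field_simp
  have hps : Summable fun k => 1 - ‖coeff (S k) (g k) τ‖ ^ 2 :=
    summable_of_sum_range_le (fun k => hnn k τ) (hsum τ hτ'.le le_rfl)
  have hα : Tendsto (fun k => (τ : ℝ)⁻¹ • ∫ r in (0 : ℝ)..τ, coeff (S k) (g k) r) atTop (𝓝 1) := by
    have h1 : Tendsto (fun k => ∫ r in (0 : ℝ)..τ, coeff (S k) (g k) r) atTop
        (𝓝 (∫ _ in (0 : ℝ)..τ, (1 : ℂ))) := by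
      refine intervalIntegral.tendsto_integral_filter_of_dominated_convergence (fun _ => 1) ?_ ?_
        (continuous_const.intervalIntegrable _ _) ?_
      · exact Eventually.of_forall fun k => (hcont k).aestronglyMeasurable
      · exact Eventually.of_forall fun k => Eventually.of_forall fun r _ =>
          (hS k).norm_coeff_le_one (hg k) r
      · refine Eventually.of_forall fun r hr => ?_
        rw [Set.uIoc_of_le hτ'.le] at hr
        exact hlim r hr.1.le hr.2
    have h2 := h1.const_smul (τ : ℝ)⁻¹
    have h3 : (τ : ℝ)⁻¹ • ∫ _ in (0 : ℝ)..τ, (1 : ℂ) = 1 := by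
      rw [intervalIntegral.integral_const, sub_zero, smul_smul, inv_mul_cancel₀ hτ'.ne', one_smul]
    rwa [h3] at h2
  -- The estimates are conditional because the averaged coefficient may be small in finitely many
  -- slots, which affect neither boundedness nor summability.
  have hex : ∀ k, ∃ x a : H k, ‖x‖ = 1 ∧ HasGenerator (S k) x a ∧
      (1 / 2 ≤ ‖(τ : ℝ)⁻¹ • ∫ r in (0 : ℝ)..τ, coeff (S k) (g k) r‖ →
        ‖1 - ⟪x, g k⟫_ℂ‖ ≤ 4 * q k ∧ ‖a‖ ≤ 4 / τ ∧ ‖a - ⟪x, a⟫_ℂ • x‖ ^ 2 ≤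
          128 / τ ^ 2 * ((1 - ‖coeff (S k) (g k) τ‖ ^ 2) + q k)) := by
    intro k
    by_cases h : 1 / 2 ≤ ‖(τ : ℝ)⁻¹ • ∫ r in (0 : ℝ)..τ, coeff (S k) (g k) r‖
    · obtain ⟨x, a, h1, h2, h3⟩ := (hS k).exists_hasGenerator_near (hg k) hτ rfl h
      exact ⟨x, a, h1, h2, fun _ => h3⟩
    · obtain ⟨x, a, h1, h2⟩ := (hS k).exists_unit_hasGenerator
      exact ⟨x, a, h1, h2, fun h' => absurd h' h⟩
  choose x a hx ha hxa using hex
  have hev : ∀ᶠ k in atTop,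
      1 / 2 ≤ ‖(τ : ℝ)⁻¹ • ∫ r in (0 : ℝ)..τ, coeff (S k) (g k) r‖ :=
    hα.norm.eventually_const_le (by rw [norm_one]; norm_num)
  have hbdd : BddAbove (Set.range fun k => ‖a k‖) :=
    (isBoundedUnder_of_eventually_le (hev.mono fun k hk => (hxa k hk).2.1)).bddAbove_range
  obtain ⟨C, hC⟩ := hbdd
  refine ⟨⟨x, by simp [hx]⟩, a, C, hx, ?_, ha, fun k => hC ⟨k, rfl⟩, ?_⟩
  · refine (hqs.mul_left 4).of_norm_bounded_eventually_nat ?_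
    filter_upwards [hev] with k hk
    rw [norm_norm]
    exact (hxa k hk).1
  · refine ((hps.add hqs).mul_left (128 / (τ : ℝ) ^ 2)).of_norm_bounded_eventually_nat ?_
    filter_upwards [hev] with k hk
    rw [Real.norm_of_nonneg (sq_nonneg _)]
    exact (hxa k hk).2.2

/-- Each coefficient is nearly exp(s⟨f_k, a_k⟩), with summable relative errors. Dividing one nonzero
convergent product by another leaves the product of the exp(-s⟨f_k, a_k⟩), to which
`cauchySeq_of_tendsto_exp` applies. -/
theorem cauchySeq_sum_inner {S : ∀ k, ℝ≥0 → H k →L[ℂ] H k}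
    (hS : ∀ k, IsContractionSemigroup (S k)) {f : C0Seq H} {a : ∀ k, H k} {C : ℝ}
    (hf : ∀ k, ‖f k‖ = 1) (ha : ∀ k, HasGenerator (S k) (f k) (a k)) (hC : ∀ k, ‖a k‖ ≤ C)
    (hb : Summable fun k => ‖a k - ⟪f k, a k⟫_ℂ • f k‖ ^ 2) {δ : ℝ≥0} (hδ : 0 < δ)
    (hcoeff : ∀ s : ℝ, 0 ≤ s → s ≤ δ →
      (∃ c : ℂ, c ≠ 0 ∧
        Tendsto (fun n => ∏ k ∈ Finset.range n, coeff (S k) (f k) s) atTop (𝓝 c)) ∧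
      ∀ n, ∑ k ∈ Finset.range n, (1 - ‖coeff (S k) (f k) s‖ ^ 2) ≤ 2) :
    CauchySeq fun n => ∑ k ∈ Finset.range n, ⟪f k, a k⟫_ℂ := by
  refine cauchySeq_of_tendsto_exp (δ := δ) hδ fun s h0 hs => ?_
  obtain ⟨⟨c, hc0, hc⟩, -⟩ := hcoeff s h0 hs
  set w : ℕ → ℂ := fun k => Complex.exp (-(s * ⟪f k, a k⟫_ℂ)) * coeff (S k) (f k) s with hw
  have hcoeff0 : ∀ k, coeff (S k) (f k) s ≠ 0 := by
    intro k hk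
    refine hc0 (tendsto_nhds_unique hc (tendsto_const_nhds.congr' ?_))
    filter_upwards [eventually_gt_atTop k] with n hn
    exact (Finset.prod_eq_zero (Finset.mem_range.mpr hn) hk).symm
  have hws : Summable fun k => ‖w k - 1‖ := by
    set β := ∑' k, ‖a k - ⟪f k, a k⟫_ℂ • f k‖ ^ 2 with hβ
    refine summable_of_sum_range_le
      -- Here 2 bounds the summed deficiencies at each time r ≤ s, and β the summed squared
      -- deviations.
      (c := Real.exp (C * s) * ∫ _ in (0 : ℝ)..s, (2 + β) / 2) (fun k => norm_nonneg _) fun n => ?_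
    have hcont : ∀ k, Continuous fun r => ((1 - ‖coeff (S k) (f k) r‖ ^ 2) +
        ‖a k - ⟪f k, a k⟫_ℂ • f k‖ ^ 2) / 2 := fun k => by
      have := (hS k).continuous_coeff (f k)
      fun_prop
    refine (Finset.sum_le_sum fun k _ => (hS k).norm_exp_mul_coeff_sub_one_le (hf k) (ha k)
      (hC k) h0).trans ?_
    rw [← Finset.mul_sum, ← intervalIntegral.integral_finsetSum
      fun k _ => (hcont k).intervalIntegrable _ _]
    refine mul_le_mul_of_nonneg_left ?_ (Real.exp_pos _).le
    refine intervalIntegral.integral_mono_on h0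
      ((continuous_finsetSum _ fun k _ => hcont k).intervalIntegrable _ _)
      (continuous_const.intervalIntegrable _ _) fun r hr => ?_
    rw [← Finset.sum_div, Finset.sum_add_distrib]
    have h1 := (hcoeff r hr.1 (hr.2.trans hs)).2 n
    have h2 := hb.sum_le_tsum (Finset.range n) fun k _ => sq_nonneg _
    linarith
  have hw1 : ∀ k, 1 + (w k - 1) = w k := fun k => by ring
  have hW : Tendsto (fun n => ∏ k ∈ Finset.range n, w k) atTop (𝓝 (∏' k, w k)) := by
    have hm : Multipliable w :=
      (Complex.multipliable_one_add_of_summable hws.of_norm).congr hw1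
    exact hm.hasProd.tendsto_prod_nat
  have hW0 : ∏' k, w k ≠ 0 := by
    have := tprod_one_add_ne_zero_of_summable (f := fun k => w k - 1) (fun k => ?_) hws
    · simpa only [hw1] using this
    · rw [hw1]
      exact mul_ne_zero (Complex.exp_ne_zero _) (hcoeff0 k)
  refine ⟨(∏' k, w k) / c, div_ne_zero hW0 hc0, (hW.div hc hc0).congr fun n => ?_⟩
  simp only [Pi.div_apply]
  rw [← Finset.prod_div_distrib, Finset.mul_sum, ← Finset.sum_neg_distrib, Complex.exp_sum]
  refine Finset.prod_congr rfl fun k _ => ?_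
  rw [hw, mul_div_cancel_right₀ _ (hcoeff0 k)]

/-- `exists_coeff` is used twice: for the normalized sequence, to regularize it, and then for the
regularized one, whose coefficients control the expectations of the generators. -/
theorem IsReducedContractionSemigroup.exists_isStrongConvergenceVector [∀ k, Nontrivial (H k)]
    {S : ∀ k, ℝ≥0 → H k →L[ℂ] H k} (hS : ∀ k, IsContractionSemigroup (S k)) {g : C0Seq H}
    (h : IsReducedContractionSemigroup (partialTensor g) fun t => infTensorOp fun k => S k t) :
    ∃ f : C0Seq H, tensor f ∈ partialTensor g ∧
      IsStrongConvergenceVector (fun k => generator (S k)) f := by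
  obtain ⟨g', hg', hgg⟩ := exists_unit_strongEquiv g
  obtain ⟨τ, hτ, hτc⟩ := h.exists_coeff hS hg' hgg
  obtain ⟨f, a, C, hf, hfg, ha, hC, hb⟩ := exists_regularization hS hg' hτ
    (fun s h0 hs => by
      obtain ⟨⟨c, hc0, hc⟩, -⟩ := hτc s h0 hs
      exact tendsto_one_of_tendsto_prod hc0 hc)
    fun s h0 hs => (hτc s h0 hs).2
  obtain ⟨δ, hδ, hδc⟩ := h.exists_coeff hS hf (hfg.trans hgg)
  have hv := cauchySeq_sum_tensor_update hf (cauchySeq_sum_inner hS hf ha hC hb hδ hδc) hb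
  refine ⟨f, mem_partialTensor (hfg.trans hgg), hf, fun k => (ha k).mem_domain, ?_⟩
  simp only [(ha _).generator_eq]
  exact cauchySeq_tendsto_of_complete hv

end Converse

end VonNeumann

end

open VonNeumann in
theorem theorem3p10 {H : ℕ → Type*} [∀ k, NormedAddCommGroup (H k)]
    [∀ k, InnerProductSpace ℂ (H k)] [∀ k, CompleteSpace (H k)] [∀ k, Nontrivial (H k)]
    (S : ∀ k, ℝ≥0 → H k →L[ℂ] H k) (hS : ∀ k, IsContractionSemigroup (S k)) (g : C0Seq H) :
    (IsStrongConvergenceVector (fun k => generator (S k)) g →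
      IsReducedContractionSemigroup (partialTensor g) fun t => infTensorOp fun k => S k t) ∧
    (IsReducedContractionSemigroup (partialTensor g) (fun t => infTensorOp fun k => S k t) →
      ∃ f : C0Seq H, tensor f ∈ partialTensor g ∧
        IsStrongConvergenceVector (fun k => generator (S k)) f) :=
  ⟨fun h => h.isReducedContractionSemigroup hS, fun h => h.exists_isStrongConvergenceVector hS⟩
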